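/- **Setting.** Let $\mathcal X$ be a metric space (for instance a Riemannian manifold with its distance) with its Borel $\sigma$-algebra, $f:\mathcal X\to\mathcal X$ continuous, $\mu$ an $f$-invariant Borel probability measure, and $\varphi:\mathcal X\to[-\infty,\infty]$ measurable. Put $X_j=\varphi\circ f^j$, $M_n=\max\{X_0,\dots,X_{n-1}\}$, $U(u)=\{\varphi>u\}$, and $$A_q(u)=\{X_0>u,\ X_1\le u,\dots,X_q\le u\},\qquad W_{s,\ell}(B)=\bigcap_{i=s}^{s+\max\{\ell-1,0\}}f^{-i}(B^c).$$ **Maximal points.** Let $N\ge1$. Suppose $\varphi$ attains its global maximum $u_F\in[-\infty,\infty]$ exactly at the points $\xi_1,\dots,\xi_N$, and that there are disjoint balls $B_{\delta_i}(\xi_i)$ such that for all $u<u_F$ close to $u_F$ one has $U(u)=\bigcup_{i}B_{\varepsilon_i(u)}(\xi_i)$ with $0<\varepsilon_i(u)\le\delta_i$ and $\varepsilon_i(u)\to0$ as $u\to u_F$. Suppose also that $\mu(U(u))>0$ for every real $u<u_F$. Let $\mathcal O(x)=\{f^n(x):n\ge0\}$ and assume that the orbits $\mathcal O(\xi_1),\dots,\mathcal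 O(\xi_N)$ are pairwise disjoint. Let $p_i$ be the prime period of $\xi_i$ if $\xi_i$ is periodic and $p_i=0$ otherwise. Assume that each periodic $\xi_i$ is repelling: $\operatorname{dist}(f^{p_i}(x),\xi_i)>\operatorname{dist}(x,\xi_i)$ for all $x\ne\xi_i$ in some ball around $\xi_i$. Put $q=\max_i p_i$. **Individual extremal indices.** Let $\varphi_i=\varphi$ on $B_{\delta_i}(\xi_i)$ and $\varphi_i=-\infty$ elsewhere. Assume that the process $(\varphi_i\circ f^j)_{j\ge0}$ has extremal index $\theta_i$: for every $\sigma>0$ there are real levels $v_n$ with $n\mu(\varphi_i>v_n)\to\sigma$ and $\mu(\max_{0\le j<n}\varphi_i\circ f^j\le v_n)\to e^{-\theta_i\sigma}$. **Levels.** Let $\tau>0$, let $u_n$ be real levels with $n\mu(X_0>u_n)\to\tau$, put $U_n=U(u_n)$, $U_n(\xi_i)=U_n\cap B_{\delta_i}(\xi_i)$, $A_{q,n}=A_q(u_n)$, and suppose that the limits $\alpha_i=\lim_n\mu(U_n(\xi_i))/\mu(U_n)$ exist. **Assumption A.** There are a Banach space $\mathcal C_1$ of real-valued measurable functions on $\mathcal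 X$ and a summable sequence $(\rho_n)$ such that for all $\phi\in\mathcal C_1$, $\psi\in L^1(\mu)$ and $n\ge1$, the functions $\phi$ and $\phi\cdot(\psi\circ f^n)$ are integrable and $$\Big|\int\phi\,(\psi\circ f^n)\,d\mu-\int\phi\,d\mu\int\psi\,d\mu\Big|\le\rho_n\|\phi\|_{\mathcal C_1}\|\psi\|_{1};$$ moreover there is $C>0$ such that, for all $n\ge1$, $\mathbf 1_{A_{q,n}}$ coincides $\mu$-a.e. with an element of $\mathcal C_1$ of norm at most $C$. **Conclusion.** 1. *Condition $D_q(u_n)$ holds*: there are integers $t_n\ge1$ with $t_n=o(n)$ and numbers $\gamma(n,t)$, nonincreasing in $t$ for each $n$, with $n\gamma(n,t_n)\to0$ and, for all $\ell,t,n\in\mathbb N_0$, $$\big|\mu(A_{q,n}\cap W_{t,\ell}(A_{q,n}))-\mu(A_{q,n})\,\mu(W_{0,\ell}(A_{q,n}))\big|\le\gamma(n,t).$$ 2. *Condition $D'_q(u_n)$ holds*: for every sequence $(t_n)$ as in 1 there are integers $k_n\to\infty$ with $k_nt_n=o(n)$ and $$\lim_{n\to\infty}n\sum_{j=q+1}^{\lfloor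 n/k_n\rfloor-1}\mu\big(A_{q,n}\cap f^{-j}(A_{q,n})\big)=0.$$ 3. $\displaystyle\lim_{n\to\infty}\mu(M_n\le u_n)=e^{-\theta\tau}$, where $\theta=\sum_{i=1}^N\alpha_i\theta_i$. -/

import Mathlib

open Set Filter Topology MeasureTheory

namespace MultipleMaxima

noncomputable section

/-- The forward orbit `{x, f x, f (f x), …}`. -/
def orbit {X : Type*} (f : X → X) (x : X) : Set X := Set.range fun n : ℕ => f^[n] x

/-- The exceedance set `U(u) = {φ > u}`. -/
def exceed {X : Type*} (φ : X → EReal) (u : ℝ) : Set X := {x | (u : EReal) < φ x}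

/-- The event `A_q(u) = {X₀ > u, X₁ ≤ u, …, X_q ≤ u}` for the process `X_j = φ ∘ f^j`. -/
def escape {X : Type*} (f : X → X) (φ : X → EReal) (q : ℕ) (u : ℝ) : Set X :=
  exceed φ u ∩ ⋂ j ∈ Finset.Icc 1 q, f^[j] ⁻¹' (exceed φ u)ᶜ

/-- The event `W_{s,ℓ}(B)`: the orbit avoids `B` at the times `s, …, s + max (ℓ - 1) 0`
(the subtraction is truncated). -/
def avoid {X : Type*} (f : X → X) (B : Set X) (s l : ℕ) : Set X :=
  ⋂ j ∈ Finset.Icc s (s + (l - 1)), f^[j] ⁻¹' Bᶜ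

/-- The partial maximum `M_n = max {X₀, …, X_{n-1}}`, with `X_j = φ ∘ f^j`. -/
def partialMax {X : Type*} (f : X → X) (φ : X → EReal) (n : ℕ) (x : X) : EReal :=
  (Finset.range n).sup fun j => φ (f^[j] x)

/-- The levels `u n` are normalising with parameter `τ`: `n μ(X₀ > u n) → τ`. -/
def IsNormalising {X : Type*} [MeasurableSpace X] (μ : Measure X) (φ : X → EReal)
    (u : ℕ → ℝ) (τ : ℝ) : Prop :=
  Tendsto (fun n : ℕ => (n : ℝ) * μ.real (exceed φ (u n))) atTop (𝓝 τ)

/-- The process `φ ∘ f^j` has an extreme value law with extremal index `θ`: for every `τ > 0` there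
are normalising levels `u n` with parameter `τ` such that `μ(M_n ≤ u n) → exp (-θ τ)`. -/
def HasExtremalIndex {X : Type*} [MeasurableSpace X] (μ : Measure X) (f : X → X)
    (φ : X → EReal) (θ : ℝ) : Prop :=
  ∀ τ : ℝ, 0 < τ → ∃ u : ℕ → ℝ, IsNormalising μ φ u τ ∧
    Tendsto (fun n : ℕ => μ.real {x | partialMax f φ n x ≤ (u n : EReal)}) atTop
      (𝓝 (Real.exp (-(θ * τ))))

open Classical in
/-- The observable that equals `φ` on `B` and `-∞` off `B`. With `B` a ball around one of the
maximal points of `φ` that meets no other peak, this is an observable with the same peak as `φ`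
at that point and no other maximal point. -/
def localised {X : Type*} (φ : X → EReal) (B : Set X) : X → EReal :=
  fun x => if x ∈ B then φ x else ⊥

/-- Real levels `u` increasing to `uF`, staying below `uF`. -/
def levels (uF : EReal) : Filter ℝ := comap Real.toEReal (𝓝[<] uF)

/-- `φ` has its global maximum `uF` exactly at the points `ξ i`; the balls `B(ξ i, δ i)` are
disjoint; for levels `u < uF` close to `uF` the set `{φ > u}` is the union of balls
`B(ξ i, ε i u) ⊆ B(ξ i, δ i)`, whose radii tend to `0` as `u → uF`; and `uF` is the right endpoint
of the distribution of `φ` under `μ`. -/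
structure HasMaximalPoints {X : Type*} [MetricSpace X] [MeasurableSpace X] (μ : Measure X)
    (φ : X → EReal) {N : ℕ} (ξ : Fin N → X) (uF : EReal) (δ : Fin N → ℝ)
    (ε : Fin N → ℝ → ℝ) : Prop where
  le_max : ∀ x, φ x ≤ uF
  eq_max_iff : ∀ x, φ x = uF ↔ ∃ i, x = ξ i
  disjoint_balls : Pairwise fun i j => Disjoint (Metric.ball (ξ i) (δ i)) (Metric.ball (ξ j) (δ j))
  radius : ∀ i, ∀ᶠ u in levels uF, 0 < ε i u ∧ ε i u ≤ δ i
  exceed_eq : ∀ᶠ u in levels uF, exceed φ u = ⋃ i, Metric.ball (ξ i) (ε i u)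
  radius_tendsto : ∀ i, Tendsto (ε i) (levels uF) (𝓝 0)
  endpoint : ∀ u : ℝ, (u : EReal) < uF → 0 < μ (exceed φ u)

/-- A periodic point `z` of prime period `p` is repelling: all points `x ≠ z` near `z` are moved
strictly away from `z` by `f^p`. -/
def IsRepelling {X : Type*} [MetricSpace X] (f : X → X) (z : X) : Prop :=
  ∃ r : ℝ, 0 < r ∧ ∀ x ∈ Metric.ball z r, x ≠ z →
    dist x z < dist (f^[Function.minimalPeriod f z] x) z

/-- Summable decay of correlations of observables in the Banach space `C₁` against `L¹(μ)`
observables. The elements of `C₁` are regarded as functions through the linear map `toFun`. -/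
def SummableDecay {X : Type*} [MeasurableSpace X] (μ : Measure X) (f : X → X)
    {C₁ : Type*} [NormedAddCommGroup C₁] [NormedSpace ℝ C₁] (toFun : C₁ →ₗ[ℝ] (X → ℝ)) : Prop :=
  ∃ ρ : ℕ → ℝ, Summable ρ ∧
    ∀ (g : C₁) (ψ : X → ℝ), Integrable ψ μ → ∀ n : ℕ, 1 ≤ n →
      Integrable (toFun g) μ ∧ Integrable (fun x => toFun g x * ψ (f^[n] x)) μ ∧
      |∫ x, toFun g x * ψ (f^[n] x) ∂μ - (∫ x, toFun g x ∂μ) * ∫ x, ψ x ∂μ| ≤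
        ρ n * (‖g‖ * ∫ x, |ψ x| ∂μ)

/-- Assumption A: summable decay of correlations against `L¹`, and the indicators of the events
`A_q(u n)` belong to `C₁` (as classes mod `μ`-null sets) with uniformly bounded norms. -/
def AssumptionA {X : Type*} [MeasurableSpace X] (μ : Measure X) (f : X → X) (φ : X → EReal)
    (q : ℕ) (u : ℕ → ℝ) {C₁ : Type*} [NormedAddCommGroup C₁] [NormedSpace ℝ C₁]
    (toFun : C₁ →ₗ[ℝ] (X → ℝ)) : Prop :=
  SummableDecay μ f toFun ∧
    ∃ C : ℝ, 0 < C ∧ ∀ n : ℕ, 1 ≤ n →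
      ∃ g : C₁, toFun g =ᵐ[μ] (escape f φ q (u n)).indicator (fun _ => (1 : ℝ)) ∧ ‖g‖ ≤ C

/-- Condition `D_q(u_n)`, with the sequence `t_n` made explicit. -/
def CondD {X : Type*} [MeasurableSpace X] (μ : Measure X) (f : X → X) (φ : X → EReal)
    (q : ℕ) (u : ℕ → ℝ) (t : ℕ → ℕ) : Prop :=
  (∀ n, 1 ≤ t n) ∧ Tendsto (fun n : ℕ => (t n : ℝ) / n) atTop (𝓝 0) ∧
    ∃ γ : ℕ → ℕ → ℝ, (∀ n, Antitone (γ n)) ∧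
      Tendsto (fun n : ℕ => (n : ℝ) * γ n (t n)) atTop (𝓝 0) ∧
      ∀ l s n : ℕ,
        |μ.real (escape f φ q (u n) ∩ avoid f (escape f φ q (u n)) s l) -
          μ.real (escape f φ q (u n)) * μ.real (avoid f (escape f φ q (u n)) 0 l)| ≤ γ n s

/-- Condition `D'_q(u_n)`, relative to the sequence `t_n` of condition `D_q(u_n)`. -/
def CondD' {X : Type*} [MeasurableSpace X] (μ : Measure X) (f : X → X) (φ : X → EReal)
    (q : ℕ) (u : ℕ → ℝ) (t : ℕ → ℕ) : Prop :=
  ∃ k : ℕ → ℕ, Tendsto k atTop atTop ∧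
    Tendsto (fun n : ℕ => ((k n : ℝ) * t n) / n) atTop (𝓝 0) ∧
    Tendsto (fun n : ℕ => (n : ℝ) * ∑ j ∈ Finset.Ico (q + 1) (n / k n),
      μ.real (escape f φ q (u n) ∩ f^[j] ⁻¹' escape f φ q (u n))) atTop (𝓝 0)

end

end MultipleMaxima

open MultipleMaxima

/-! Write `U_n` for the exceedance set, `A_n` for the escape event `A_q(u_n)`, and `w_l` for the
probability that an orbit avoids `A_n` at the times `0, …, l - 1`.

Geometry. For each fixed `j ≥ 1`, `A_n` has no return at time `j` once `n` is large. By continuity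
such a return joins two maximal points along an orbit; disjointness of orbits makes them the same
periodic point, of period `p ∣ j`. But escaping means being outside the small ball at time `p`, and
repulsion then prevents re-entry at the later multiples of `p`. By a diagonal choice, no return
occurs before a time `R_n → ∞`.

Decay. Correlations of `A_n` with a later event `E` cost `r_j μ(E)`, where `r` is summable. With `E
= A_n` the returns up to time `m` have total probability at most `m μ(U_n)^2 + o(1/n)`, which gives
`D'`. When `E` is the absence of visits, `μ(E)` need not be small, so the window is first shifted to
a time where `r` is small, at the price of a few returns. The resulting error is `o(1/n)` for every
gap `s ≥ 1`, so `D` holds even with `t_n = 1`.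

Law. By stationarity `w_{l+1} = w_l - μ(A_n, then no visit at times 1, …, l) = (1 - μ(A_n)) w_l +
o(1/n)`, uniformly in `l`; hence `w_n` is asymptotic to `(1 - μ(A_n))^n`. Avoiding `A_n` and
avoiding `U_n` differ only through the last `q` times, so the limit of `n μ(A_n)` remains to be
found.

Indices. `A_n` splits over the peaks. In a block of length `n / K`, the chance of hitting one piece
is nearly its length times the measure of the piece, as returns are rare; the extremal index gives
the same chance as `1 - exp(-θ_i α_i τ / K)`. Letting `K → ∞` yields `θ_i α_i τ` for that piece. -/

namespace MultipleMaxima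

/-- The event that the orbit avoids `B` at the times `0, …, l - 1`. -/
def noHit {X : Type*} (f : X → X) (B : Set X) (l : ℕ) : Set X := {x | ∀ j < l, f^[j] x ∉ B}

/-! ### Avoidance probabilities for a stationary orbit -/

section Hitting

variable {X : Type*} {f : X → X} {B U V : Set X}

lemma noHit_zero : noHit f B 0 = univ := by
  ext x; simp [noHit]

lemma noHit_succ (l : ℕ) : noHit f B (l + 1) = f ⁻¹' noHit f B l \ B := by
  ext x
  simp only [noHit, mem_ofPred_eq, Set.mem_sdiff, mem_preimage]
  constructor
  · intro h
    exact ⟨fun j hj => by simpa using h (j + 1) (by omega), by simpa using h 0 (by omega)⟩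
  · rintro ⟨h₁, h₂⟩ j hj
    cases j with
    | zero => simpa using h₂
    | succ j => simpa using h₁ j (by omega)

lemma noHit_anti (h : V ⊆ U) (l : ℕ) : noHit f U l ⊆ noHit f V l :=
  fun _ hx j hj hv => hx j hj (h hv)

lemma avoid_eq_preimage_noHit (s l : ℕ) :
    avoid f B s l = f^[s] ⁻¹' noHit f B (l - 1 + 1) := by
  ext x
  simp only [avoid, noHit, mem_iInter, Finset.mem_Icc, mem_preimage, mem_compl_iff, mem_ofPred_eq,
    ← Function.iterate_add_apply]
  constructor
  · intro h j hj
    exact h (j + s) ⟨by omega, by omega⟩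
  · intro h j hj
    have := h (j - s) (by omega)
    rwa [Nat.sub_add_cancel hj.1] at this

lemma setOf_partialMax_le (φ : X → EReal) (n : ℕ) (u : ℝ) :
    {x | partialMax f φ n x ≤ (u : EReal)} = noHit f (exceed φ u) n := by
  ext x
  simp [partialMax, noHit, exceed, Finset.sup_le_iff]

/-- The last exceedance before time `l` has no exceedance after it in the window. If it occurs
before `l - q`, it is therefore an escape. -/
lemma noHit_escape_subset (φ : X → EReal) (q l : ℕ) (u : ℝ) :
    noHit f (escape f φ q u) l ⊆
      noHit f (exceed φ u) l ∪ ⋃ j ∈ Finset.Ico (l - q) l, f^[j] ⁻¹' exceed φ u := by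
  classical
  intro x hx
  by_contra hcon
  simp only [mem_union, not_or, mem_iUnion, Finset.mem_Ico, mem_preimage, not_exists, noHit,
    mem_ofPred_eq, not_forall, not_not] at hcon
  obtain ⟨⟨j₀, hj₀, hjU⟩, htail⟩ := hcon
  set P : ℕ → Prop := fun j => j < l ∧ f^[j] x ∈ exceed φ u with hP
  have hs : P (Nat.findGreatest P l) :=
    Nat.findGreatest_spec (P := P) hj₀.le ⟨hj₀, hjU⟩
  set j := Nat.findGreatest P l with hj
  have hjl : j < l - q := by
    by_contra hlt
    exact htail j ⟨by omega, hs.1⟩ hs.2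
  refine hx j hs.1 ⟨hs.2, ?_⟩
  simp only [mem_iInter, Finset.mem_Icc, mem_preimage, mem_compl_iff,
    ← Function.iterate_add_apply]
  intro i hi hmem
  have : i + j ≤ j :=
    Nat.le_findGreatest (P := P) (by omega) ⟨by omega, hmem⟩
  omega

variable [MeasurableSpace X] {μ : Measure X}

lemma measurableSet_noHit (hf : Measurable f) (hB : MeasurableSet B) (l : ℕ) :
    MeasurableSet (noHit f B l) := by
  induction l with
  | zero => simp [noHit_zero]
  | succ l ih => rw [noHit_succ]; exact (hf ih).diff hB

lemma real_preimage_iterate (hμ : MeasurePreserving f μ μ) (hB : MeasurableSet B) (j : ℕ) :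
    μ.real (f^[j] ⁻¹' B) = μ.real B :=
  (hμ.iterate j).measureReal_preimage hB.nullMeasurableSet

variable [IsProbabilityMeasure μ]

/-- Prepending a time and using invariance turns the loss of one step into a visit at time `0`
followed by a free window. Telescoping this yields all the block estimates. -/
lemma real_noHit_sub_succ (hμ : MeasurePreserving f μ μ) (hB : MeasurableSet B) (l : ℕ) :
    μ.real (noHit f B l) - μ.real (noHit f B (l + 1)) = μ.real (B ∩ f ⁻¹' noHit f B l) := by
  have h := measureReal_sdiff_add_inter (μ := μ) (s := f ⁻¹' noHit f B l) hB
  have h₁ := real_preimage_iterate hμ (measurableSet_noHit hμ.measurable hB l) 1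
  simp only [Function.iterate_one] at h₁
  rw [noHit_succ, inter_comm]
  linarith

lemma le_real_inter_preimage_noHit (l : ℕ) :
    μ.real B - ∑ j ∈ Finset.Ico 1 (l + 1), μ.real (B ∩ f^[j] ⁻¹' B) ≤
      μ.real (B ∩ f ⁻¹' noHit f B l) := by
  have hsub : B ⊆ (B ∩ f ⁻¹' noHit f B l) ∪ ⋃ j ∈ Finset.Ico 1 (l + 1), B ∩ f^[j] ⁻¹' B := by
    intro x hx
    by_cases h : x ∈ f ⁻¹' noHit f B l
    · exact Or.inl ⟨hx, h⟩
    · right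
      simp only [mem_preimage, noHit, mem_ofPred_eq, not_forall, not_not] at h
      obtain ⟨j, hj, hjB⟩ := h
      simp only [mem_iUnion]
      exact ⟨j + 1, by simp; omega, hx, by simpa using hjB⟩
  have h₁ := measureReal_mono (μ := μ) hsub
  have h₂ := measureReal_union_le (μ := μ) (B ∩ f ⁻¹' noHit f B l)
    (⋃ j ∈ Finset.Ico 1 (l + 1), B ∩ f^[j] ⁻¹' B)
  have h₃ := measureReal_biUnion_finset_le (μ := μ) (Finset.Ico 1 (l + 1))
    (fun j => B ∩ f^[j] ⁻¹' B)
  linarith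

lemma one_sub_real_noHit_le (hμ : MeasurePreserving f μ μ) (hB : MeasurableSet B) (l : ℕ) :
    1 - μ.real (noHit f B l) ≤ l * μ.real B := by
  induction l with
  | zero => simp [noHit_zero]
  | succ l ih =>
    have h₁ := real_noHit_sub_succ hμ hB l
    have h₂ : μ.real (B ∩ f ⁻¹' noHit f B l) ≤ μ.real B := measureReal_mono inter_subset_left
    push_cast
    linarith

lemma le_one_sub_real_noHit (hμ : MeasurePreserving f μ μ) (hB : MeasurableSet B) {l m : ℕ}
    (hlm : l ≤ m) :
    l * (μ.real B - ∑ j ∈ Finset.Ico 1 m, μ.real (B ∩ f^[j] ⁻¹' B)) ≤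
      1 - μ.real (noHit f B l) := by
  induction l with
  | zero => simp [noHit_zero]
  | succ l ih =>
    have h₁ := real_noHit_sub_succ hμ hB l
    have h₂ := le_real_inter_preimage_noHit (μ := μ) (f := f) (B := B) l
    have h₃ : ∑ j ∈ Finset.Ico 1 (l + 1), μ.real (B ∩ f^[j] ⁻¹' B) ≤
        ∑ j ∈ Finset.Ico 1 m, μ.real (B ∩ f^[j] ⁻¹' B) :=
      Finset.sum_le_sum_of_subset_of_nonneg (Finset.Ico_subset_Ico_right hlm)
        fun _ _ _ => measureReal_nonneg
    have := ih (by omega)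
    push_cast
    linarith

/-- The windows `[s, s + l)` and `[t, t + l)` differ only at times in `[s, t)` and `[s + l, t + l)`,
so shifting one to the other is paid for by returns at those times. The windows need not overlap. -/
lemma abs_real_inter_preimage_noHit_sub_le {s t : ℕ} (hst : s ≤ t) (l : ℕ) :
    |μ.real (B ∩ f^[s] ⁻¹' noHit f B l) - μ.real (B ∩ f^[t] ⁻¹' noHit f B l)| ≤
      ∑ j ∈ Finset.Ico s t, μ.real (B ∩ f^[j] ⁻¹' B) +
        ∑ j ∈ Finset.Ico (s + l) (t + l), μ.real (B ∩ f^[j] ⁻¹' B) := by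
  -- One-sided form: `I` need only contain the times of the window at `b` that are missing from the
  -- window at `a`.
  have key : ∀ (a b : ℕ) (I : Finset ℕ), (∀ j < l, j + b ∈ I ∨ ∃ i < l, j + b = i + a) →
      μ.real (B ∩ f^[a] ⁻¹' noHit f B l) - μ.real (B ∩ f^[b] ⁻¹' noHit f B l) ≤
        ∑ j ∈ I, μ.real (B ∩ f^[j] ⁻¹' B) := by
    intro a b I hI
    have hsub : B ∩ f^[a] ⁻¹' noHit f B l ⊆
        (B ∩ f^[b] ⁻¹' noHit f B l) ∪ ⋃ j ∈ I, B ∩ f^[j] ⁻¹' B := by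
      rintro x ⟨hx, hxa⟩
      by_cases h : x ∈ f^[b] ⁻¹' noHit f B l
      · exact Or.inl ⟨hx, h⟩
      · right
        simp only [mem_preimage, noHit, mem_ofPred_eq, not_forall, not_not,
          ← Function.iterate_add_apply] at h hxa
        obtain ⟨j, hj, hjB⟩ := h
        rcases hI j hj with h | ⟨i, hi, hij⟩
        · simp only [mem_iUnion]
          exact ⟨j + b, h, hx, hjB⟩
        · rw [hij] at hjB
          exact absurd hjB (hxa i hi)
    have h₁ := measureReal_mono (μ := μ) hsub
    have h₂ := measureReal_union_le (μ := μ) (B ∩ f^[b] ⁻¹' noHit f B l)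
      (⋃ j ∈ I, B ∩ f^[j] ⁻¹' B)
    have h₃ := measureReal_biUnion_finset_le (μ := μ) I (fun j => B ∩ f^[j] ⁻¹' B)
    linarith
  have h₁ := key s t (Finset.Ico (s + l) (t + l)) (by
    intro j hj
    by_cases h : s + l ≤ j + t
    · left; simp; omega
    · right; exact ⟨j + t - s, by omega, by omega⟩)
  have h₂ := key t s (Finset.Ico s t) (by
    intro j hj
    by_cases h : j + s < t
    · left; simp; omega
    · right; exact ⟨j + s - t, by omega, by omega⟩)
  have h₃ : 0 ≤ ∑ j ∈ Finset.Ico s t, μ.real (B ∩ f^[j] ⁻¹' B) :=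
    Finset.sum_nonneg fun _ _ => measureReal_nonneg
  have h₄ : 0 ≤ ∑ j ∈ Finset.Ico (s + l) (t + l), μ.real (B ∩ f^[j] ⁻¹' B) :=
    Finset.sum_nonneg fun _ _ => measureReal_nonneg
  rw [abs_le]
  constructor <;> linarith

lemma real_noHit_sub_le_of_subset (hμ : MeasurePreserving f μ μ) (hU : MeasurableSet U)
    (hV : MeasurableSet V) (h : V ⊆ U) (l : ℕ) :
    μ.real (noHit f V l) - μ.real (noHit f U l) ≤ l * (μ.real U - μ.real V) := by
  have hsub : noHit f V l ⊆ noHit f U l ∪ ⋃ j ∈ Finset.range l, f^[j] ⁻¹' (U \ V) := by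
    intro x hx
    by_cases hxU : x ∈ noHit f U l
    · exact Or.inl hxU
    · right
      simp only [noHit, mem_ofPred_eq, not_forall, not_not] at hxU
      obtain ⟨j, hj, hjU⟩ := hxU
      simp only [mem_iUnion]
      exact ⟨j, by simpa using hj, hjU, hx j hj⟩
  have h₁ := measureReal_mono (μ := μ) hsub
  have h₂ := measureReal_union_le (μ := μ) (noHit f U l)
    (⋃ j ∈ Finset.range l, f^[j] ⁻¹' (U \ V))
  have h₃ := measureReal_biUnion_finset_le (μ := μ) (Finset.range l)
    (fun j => f^[j] ⁻¹' (U \ V))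
  simp only [real_preimage_iterate hμ (hU.diff hV), Finset.sum_const, Finset.card_range,
    nsmul_eq_mul] at h₃
  rw [measureReal_sdiff h hV] at h₃
  linarith

/-- For nested sets the discrepancy is a visit to the difference, so only the two measures matter.
Exceedance sets are always nested, which makes the limit law independent of the choice of
normalising levels. -/
lemma abs_real_noHit_sub_le_of_total (hμ : MeasurePreserving f μ μ) (hU : MeasurableSet U)
    (hV : MeasurableSet V) (h : V ⊆ U ∨ U ⊆ V) (l : ℕ) :
    |μ.real (noHit f V l) - μ.real (noHit f U l)| ≤ |l * μ.real U - l * μ.real V| := by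
  rcases h with h | h
  · have h₁ := real_noHit_sub_le_of_subset hμ hU hV h l
    have h₂ : μ.real (noHit f U l) ≤ μ.real (noHit f V l) := measureReal_mono (noHit_anti h l)
    rw [abs_of_nonneg (by linarith)]
    exact h₁.trans ((mul_sub _ _ _).le.trans (le_abs_self _))
  · have h₁ := real_noHit_sub_le_of_subset hμ hV hU h l
    have h₂ : μ.real (noHit f V l) ≤ μ.real (noHit f U l) := measureReal_mono (noHit_anti h l)
    rw [abs_sub_comm, abs_of_nonneg (by linarith), abs_sub_comm]
    exact h₁.trans ((mul_sub _ _ _).le.trans (le_abs_self _))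

lemma abs_real_noHit_escape_sub_le (hμ : MeasurePreserving f μ μ) {φ : X → EReal} {u : ℝ}
    (hU : MeasurableSet (exceed φ u)) (q l : ℕ) :
    |μ.real (noHit f (escape f φ q u) l) - μ.real (noHit f (exceed φ u) l)| ≤
      q * μ.real (exceed φ u) := by
  have h₀ : μ.real (noHit f (exceed φ u) l) ≤ μ.real (noHit f (escape f φ q u) l) :=
    measureReal_mono (noHit_anti inter_subset_left l)
  have h₁ := measureReal_mono (μ := μ) (noHit_escape_subset (f := f) φ q l u)
  have h₂ := measureReal_union_le (μ := μ) (noHit f (exceed φ u) l)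
    (⋃ j ∈ Finset.Ico (l - q) l, f^[j] ⁻¹' exceed φ u)
  have h₃ := measureReal_biUnion_finset_le (μ := μ) (Finset.Ico (l - q) l)
    (fun j => f^[j] ⁻¹' exceed φ u)
  simp only [real_preimage_iterate hμ hU, Finset.sum_const, Nat.card_Ico, nsmul_eq_mul] at h₃
  have h₄ : ((l - (l - q) : ℕ) : ℝ) ≤ q := by exact_mod_cast (by omega)
  have h₅ := mul_le_mul_of_nonneg_right h₄ (measureReal_nonneg (μ := μ) (s := exceed φ u))
  rw [abs_of_nonneg (by linarith)]
  linarith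

end Hitting

/-! ### Exceedance sets near the maximal points and absence of short returns -/

section Peaks

variable {X : Type*} [MetricSpace X] [MeasurableSpace X] [BorelSpace X]
  {μ : Measure X} [IsProbabilityMeasure μ] {f : X → X} {φ : X → EReal}
  {N : ℕ} {ξ : Fin N → X} {uF : EReal} {δ : Fin N → ℝ} {ε : Fin N → ℝ → ℝ}
  {u : ℕ → ℝ} {τ : ℝ}

omit [MetricSpace X] [BorelSpace X] [IsProbabilityMeasure μ] in
lemma measurableSet_exceed (hφ : Measurable φ) (v : ℝ) : MeasurableSet (exceed φ v) :=
  hφ measurableSet_Ioi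

omit [MetricSpace X] [BorelSpace X] [IsProbabilityMeasure μ] in
lemma measurableSet_escape (hf : Measurable f) (hφ : Measurable φ) (q : ℕ) (v : ℝ) :
    MeasurableSet (escape f φ q v) := by
  refine (measurableSet_exceed hφ v).inter ?_
  exact Finset.measurableSet_biInter _ fun j _ =>
    (hf.iterate j) (measurableSet_exceed hφ v).compl

omit [MetricSpace X] [BorelSpace X] in
lemma measurable_localised (hφ : Measurable φ) {B : Set X} (hB : MeasurableSet B) :
    Measurable (localised φ B) := by
  classical
  exact Measurable.ite hB hφ measurable_const

lemma exceed_localised {Y : Type*} (φ : Y → EReal) (B : Set Y) (v : ℝ) :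
    exceed (localised φ B) v = exceed φ v ∩ B := by
  ext x
  by_cases h : x ∈ B <;> simp [exceed, localised, h]

lemma exceed_total {Y : Type*} (φ : Y → EReal) (v w : ℝ) :
    exceed φ v ⊆ exceed φ w ∨ exceed φ w ⊆ exceed φ v := by
  rcases le_total v w with h | h
  · right
    intro x (hx : (w : EReal) < φ x)
    exact lt_of_le_of_lt (EReal.coe_le_coe_iff.2 h) hx
  · left
    intro x (hx : (v : EReal) < φ x)
    exact lt_of_le_of_lt (EReal.coe_le_coe_iff.2 h) hx

omit [MetricSpace X] [BorelSpace X] [IsProbabilityMeasure μ] in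
lemma IsNormalising.tendsto_zero (hu : IsNormalising μ φ u τ) :
    Tendsto (fun n => μ.real (exceed φ (u n))) atTop (𝓝 0) := by
  have h := Tendsto.mul hu (tendsto_one_div_atTop_nhds_zero_nat (𝕜 := ℝ))
  rw [mul_zero] at h
  refine h.congr' ?_
  filter_upwards [eventually_ge_atTop 1] with n hn
  have : (n : ℝ) ≠ 0 := by positivity
  field_simp

omit [BorelSpace X] in
-- Levels at or above `uF` have no exceedances, incompatible with `τ > 0`. Levels staying below some
-- `v < uF` would keep mass at least `μ(φ > v) > 0`, incompatible with `μ(U_n) → 0`.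
lemma IsNormalising.tendsto_levels (hmax : HasMaximalPoints μ φ ξ uF δ ε) (hτ : 0 < τ)
    (hu : IsNormalising μ φ u τ) : Tendsto u atTop (levels uF) := by
  have hlt : ∀ᶠ n in atTop, (u n : EReal) < uF := by
    filter_upwards [Tendsto.eventually hu (lt_mem_nhds hτ)] with n hn
    by_contra hge
    have : exceed φ (u n) = ∅ := by
      ext x
      simpa [exceed] using (hmax.le_max x).trans (not_lt.1 hge)
    simp [this] at hn
  refine tendsto_comap_iff.2 (tendsto_nhdsWithin_iff.2 ⟨?_, hlt⟩)
  refine tendsto_order.2 ⟨fun a ha => ?_, fun b hb => ?_⟩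
  · obtain ⟨v, hav, hvF⟩ := EReal.lt_iff_exists_real_btwn.1 ha
    have hv : 0 < μ.real (exceed φ v) := by
      rw [measureReal_def]
      exact ENNReal.toReal_pos (hmax.endpoint v hvF).ne' (measure_ne_top _ _)
    filter_upwards [hu.tendsto_zero.eventually (gt_mem_nhds hv)] with n hn
    refine hav.trans (EReal.coe_lt_coe_iff.2 ?_)
    by_contra hle
    have hsub : exceed φ v ⊆ exceed φ (u n) := by
      intro x (hx : (v : EReal) < φ x)
      exact lt_of_le_of_lt (EReal.coe_le_coe_iff.2 (not_lt.1 hle)) hx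
    exact absurd (measureReal_mono (μ := μ) hsub) (not_le.2 hn)
  · filter_upwards [hlt] with n hn
    exact hn.trans hb

omit [BorelSpace X] [IsProbabilityMeasure μ] in
lemma HasMaximalPoints.eventually_exceed_inter_ball (hmax : HasMaximalPoints μ φ ξ uF δ ε)
    (hu : Tendsto u atTop (levels uF)) :
    ∀ᶠ n in atTop, (∀ i, 0 < ε i (u n) ∧
        exceed φ (u n) ∩ Metric.ball (ξ i) (δ i) = Metric.ball (ξ i) (ε i (u n))) ∧
      ∀ x ∈ exceed φ (u n), ∃ i, x ∈ Metric.ball (ξ i) (δ i) := by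
  have hr : ∀ᶠ n in atTop, ∀ i, 0 < ε i (u n) ∧ ε i (u n) ≤ δ i :=
    eventually_all.2 fun i => hu.eventually (hmax.radius i)
  filter_upwards [hr, hu.eventually hmax.exceed_eq] with n hn hU
  have hball : ∀ i, Metric.ball (ξ i) (ε i (u n)) ⊆ Metric.ball (ξ i) (δ i) := fun i =>
    Metric.ball_subset_ball (hn i).2
  refine ⟨fun i => ⟨(hn i).1, ?_⟩, fun x hx => ?_⟩
  · rw [hU]
    ext x
    simp only [mem_inter_iff, mem_iUnion]
    constructor
    · rintro ⟨⟨k, hk⟩, hi⟩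
      by_cases hik : k = i
      · exact hik ▸ hk
      · exact absurd hi (disjoint_left.1 (hmax.disjoint_balls hik) (hball k hk))
    · exact fun hx => ⟨⟨i, hx⟩, hball i hx⟩
  · rw [hU] at hx
    obtain ⟨i, hi⟩ := mem_iUnion.1 hx
    exact ⟨i, hball i hi⟩

omit [BorelSpace X] [IsProbabilityMeasure μ] in
lemma HasMaximalPoints.eventually_forall_exceed (hmax : HasMaximalPoints μ φ ξ uF δ ε)
    (hu : Tendsto u atTop (levels uF)) (i : Fin N) {P : X → Prop} (hP : ∀ᶠ x in 𝓝 (ξ i), P x) :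
    ∀ᶠ n in atTop, ∀ x ∈ exceed φ (u n) ∩ Metric.ball (ξ i) (δ i), P x := by
  obtain ⟨r, hr, hPr⟩ := Metric.eventually_nhds_iff_ball.1 hP
  filter_upwards [hmax.eventually_exceed_inter_ball hu,
    ((hmax.radius_tendsto i).comp hu).eventually (gt_mem_nhds hr)] with n hn hε x hx
  rw [(hn.1 i).2] at hx
  exact hPr x (Metric.ball_subset_ball (le_of_lt hε) hx)

omit [BorelSpace X] [IsProbabilityMeasure μ] in
-- If `f^j` does not send `ξ i` to `ξ k`, disjoint neighbourhoods of `f^j (ξ i)` and `ξ k` separate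
-- the image of the shrinking `i`-th ball from the `k`-th one.
lemma HasMaximalPoints.eventually_iterate_eq (hf : Continuous f)
    (hmax : HasMaximalPoints μ φ ξ uF δ ε) (hu : Tendsto u atTop (levels uF)) (j : ℕ)
    (i k : Fin N) :
    ∀ᶠ n in atTop, ∀ x ∈ exceed φ (u n) ∩ Metric.ball (ξ i) (δ i),
      f^[j] x ∈ exceed φ (u n) ∩ Metric.ball (ξ k) (δ k) → f^[j] (ξ i) = ξ k := by
  by_cases heq : f^[j] (ξ i) = ξ k
  · exact Eventually.of_forall fun _ _ _ _ => heq
  obtain ⟨V, W, hV, hW, hξV, hξW, hdisj⟩ := t2_separation heq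
  filter_upwards [hmax.eventually_forall_exceed hu i
      ((hf.iterate j).continuousAt.eventually (hV.mem_nhds hξV)),
    hmax.eventually_forall_exceed hu k (hW.mem_nhds hξW)] with n h₁ h₂ x hx hxk
  exact absurd (h₂ _ hxk) (disjoint_left.1 hdisj (h₁ x hx))

lemma eq_of_iterate_eq_of_disjoint_orbits {Y : Type*} {g : Y → Y} {ζ : Fin N → Y}
    (horbit : Pairwise fun i j => Disjoint (orbit g (ζ i)) (orbit g (ζ j))) {i k : Fin N} {j : ℕ}
    (h : g^[j] (ζ i) = ζ k) : k = i := by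
  by_contra hki
  exact disjoint_left.1 (horbit hki) ⟨0, rfl⟩ ⟨j, h⟩

omit [BorelSpace X] [IsProbabilityMeasure μ] in
-- Within `q` steps a point near `ξ i` can re-enter the exceedance set only near `ξ i`, because the
-- orbits are disjoint; escaping one peak is then the same as escaping all.
lemma eventually_escape_localised (hf : Continuous f) (hmax : HasMaximalPoints μ φ ξ uF δ ε)
    (horbit : Pairwise fun i j => Disjoint (orbit f (ξ i)) (orbit f (ξ j)))
    (hu : Tendsto u atTop (levels uF)) (q : ℕ) (i : Fin N) :
    ∀ᶠ n in atTop, escape f (localised φ (Metric.ball (ξ i) (δ i))) q (u n) =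
      escape f φ q (u n) ∩ Metric.ball (ξ i) (δ i) := by
  have h : ∀ᶠ n in atTop, ∀ j ∈ Finset.Icc 1 q, ∀ k,
      ∀ x ∈ exceed φ (u n) ∩ Metric.ball (ξ i) (δ i),
        f^[j] x ∈ exceed φ (u n) ∩ Metric.ball (ξ k) (δ k) → f^[j] (ξ i) = ξ k :=
    (Finset.eventually_all _).2 fun j _ => eventually_all.2 fun k =>
      hmax.eventually_iterate_eq hf hu j i k
  filter_upwards [h, hmax.eventually_exceed_inter_ball hu] with n hn hU
  ext x
  simp only [escape, exceed_localised, mem_inter_iff, mem_iInter, mem_preimage, mem_compl_iff]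
  constructor
  · rintro ⟨⟨hx, hxi⟩, h⟩
    refine ⟨⟨hx, fun j hj hjU => ?_⟩, hxi⟩
    obtain ⟨k, hk⟩ := hU.2 _ hjU
    have := eq_of_iterate_eq_of_disjoint_orbits horbit (hn j hj k x ⟨hx, hxi⟩ ⟨hjU, hk⟩)
    exact h j hj ⟨hjU, this ▸ hk⟩
  · rintro ⟨⟨hx, h⟩, hxi⟩
    exact ⟨⟨hx, hxi⟩, fun j hj hjU => h j hj hjU.1⟩

omit [BorelSpace X] [IsProbabilityMeasure μ] in
/-- The short return times of `A_q(u n)` to itself disappear as `n → ∞`. -/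
lemma eventually_escape_inter_preimage_eq_empty (hf : Continuous f)
    (hmax : HasMaximalPoints μ φ ξ uF δ ε)
    (horbit : Pairwise fun i j => Disjoint (orbit f (ξ i)) (orbit f (ξ j)))
    (hrep : ∀ i, ξ i ∈ Function.periodicPts f → IsRepelling f (ξ i))
    (hu : Tendsto u atTop (levels uF)) {q : ℕ}
    (hq : ∀ i, Function.minimalPeriod f (ξ i) ≤ q) {j : ℕ} (hj : 0 < j) :
    ∀ᶠ n in atTop, escape f φ q (u n) ∩ f^[j] ⁻¹' escape f φ q (u n) = ∅ := by
  have hnear : ∀ i, ∀ᶠ n in atTop, f^[j] (ξ i) = ξ i →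
      ∀ x ∈ exceed φ (u n) ∩ Metric.ball (ξ i) (δ i), ∀ m ∈ Finset.range (j + 1),
        f^[Function.minimalPeriod f (ξ i) * m] x ≠ ξ i →
        dist (f^[Function.minimalPeriod f (ξ i) * m] x) (ξ i) <
          dist (f^[Function.minimalPeriod f (ξ i) * (m + 1)] x) (ξ i) := by
    intro i
    by_cases hper : f^[j] (ξ i) = ξ i
    swap
    · exact Eventually.of_forall fun _ h => absurd h hper
    set p := Function.minimalPeriod f (ξ i) with hp
    obtain ⟨r, hr, hrb⟩ := hrep i (Function.mk_mem_periodicPts hj hper)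
    have hfix : ∀ m, f^[p * m] (ξ i) = ξ i := fun m =>
      (Function.isPeriodicPt_minimalPeriod f (ξ i)).mul_const m
    -- Repulsion is only local, so the start must be close enough that the finitely many iterates
    -- used all stay in the repelling ball.
    have hev : ∀ᶠ x in 𝓝 (ξ i), ∀ m ∈ Finset.range (j + 1), f^[p * m] x ∈ Metric.ball (ξ i) r := by
      refine (Finset.eventually_all _).2 fun m _ => ?_
      refine (hf.iterate (p * m)).continuousAt.eventually ?_
      rw [hfix]
      exact Metric.ball_mem_nhds _ hr
    filter_upwards [hmax.eventually_forall_exceed hu i hev] with n hn _ x hx m hm hne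
    have := hrb _ (hn x hx m hm) hne
    rwa [← hp, ← Function.iterate_add_apply, show p + p * m = p * (m + 1) by ring] at this
  filter_upwards [hmax.eventually_exceed_inter_ball hu, eventually_all.2 hnear,
    eventually_all.2 fun i => eventually_all.2 fun k => hmax.eventually_iterate_eq hf hu j i k]
    with n hU hn hjik
  rw [eq_empty_iff_forall_notMem]
  rintro x ⟨⟨hx, hesc⟩, ⟨hjx, -⟩⟩
  simp only [mem_iInter, Finset.mem_Icc, mem_preimage, mem_compl_iff] at hesc
  obtain ⟨i, hi⟩ := hU.2 x hx
  obtain ⟨k, hk⟩ := hU.2 _ hjx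
  have hik := hjik i k x ⟨hx, hi⟩ ⟨hjx, hk⟩
  obtain rfl : k = i := eq_of_iterate_eq_of_disjoint_orbits horbit hik
  have hppos : 0 < Function.minimalPeriod f (ξ k) :=
    Function.minimalPeriod_pos_of_mem_periodicPts (Function.mk_mem_periodicPts hj hik)
  obtain ⟨m, hm⟩ := Function.IsPeriodicPt.minimalPeriod_dvd (f := f) (x := ξ k) (n := j) hik
  have hstep := hn k hik x ⟨hx, hi⟩
  have hkq := hq k
  set p := Function.minimalPeriod f (ξ k)
  -- The escape condition at time `p ≤ q` starts the induction and repulsion continues it; `ε > 0`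
  -- keeps the iterates away from the fixed point `ξ k` of `f^p`.
  have hout : ∀ m : ℕ, m ≤ j → ε k (u n) ≤ dist (f^[p * (m + 1)] x) (ξ k) := by
    intro m
    induction m with
    | zero =>
      intro _
      by_contra hlt
      have : f^[p * (0 + 1)] x ∈ exceed φ (u n) ∩ Metric.ball (ξ k) (δ k) := by
        rw [(hU.1 k).2]
        exact Metric.mem_ball.2 (not_le.1 hlt)
      exact hesc p ⟨hppos, hkq⟩ (by simpa using this.1)
    | succ m ih =>
      intro hm
      have h₁ := ih (by omega)
      have hpos := (hU.1 k).1
      have hne : f^[p * (m + 1)] x ≠ ξ k := fun h => by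
        rw [h, dist_self] at h₁
        linarith
      exact h₁.trans (hstep (m + 1) (by simpa using hm) hne).le
  have hjx' : f^[j] x ∈ Metric.ball (ξ k) (ε k (u n)) := by
    rw [← (hU.1 k).2]
    exact ⟨hjx, hk⟩
  have hmpos : m ≠ 0 := by
    rintro rfl
    omega
  have hmj : m ≤ j := by
    rw [hm]
    exact Nat.le_mul_of_pos_left m hppos
  have := hout (m - 1) (by omega)
  rw [Nat.sub_add_cancel (by omega), ← hm] at this
  exact absurd (Metric.mem_ball.1 hjx') (not_lt.2 this)

end Peaks

/-! ### Choice of scales and iterated limits -/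

section Sequences

lemma sum_le_tsum_add {r : ℕ → ℝ} (hr : Summable r) (h₀ : ∀ j, 0 ≤ r j) {m : ℕ} {I : Finset ℕ}
    (hI : ∀ j ∈ I, m ≤ j) : ∑ j ∈ I, r j ≤ ∑' j, r (j + m) := by
  have h := ((summable_nat_add_iff m).2 hr).sum_le_tsum (I.image (· - m)) fun j _ => h₀ _
  refine le_trans (le_of_eq ?_) h
  rw [Finset.sum_image]
  · exact Finset.sum_congr rfl fun j hj => by rw [Nat.sub_add_cancel (hI j hj)]
  · intro a ha b hb (hab : a - m = b - m)
    have := hI a ha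
    have := hI b hb
    omega

/-- Sequences tending to infinity along which a family of eventual properties holds. -/
lemma exists_tendsto_atTop_forall {P : ℕ → ℕ → Prop} (h₀ : ∀ n, P 0 n)
    (h : ∀ J, ∀ᶠ n in atTop, P J n) : ∃ R : ℕ → ℕ, Tendsto R atTop atTop ∧ ∀ n, P (R n) n := by
  classical
  refine ⟨fun n => Nat.findGreatest (P · n) n, tendsto_atTop.2 fun J => ?_, fun n =>
    Nat.findGreatest_spec (P := (P · n)) (Nat.zero_le n) (h₀ n)⟩
  filter_upwards [h J, eventually_ge_atTop J] with n hn hJ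
  exact Nat.le_findGreatest hJ hn

/-- Here `T` will be the tail of the correlation rate and `L` the length of the window in which a
good gap is sought: short compared with `n`, yet with average rate `T(L) / L = o(1/n)`. -/
lemma exists_scale {T : ℕ → ℝ} (h₀ : ∀ n, 0 ≤ T n) (hanti : Antitone T)
    (hT : Tendsto T atTop (𝓝 0)) :
    ∃ L : ℕ → ℕ, (∀ n, 1 ≤ L n) ∧ Tendsto (fun n : ℕ => (L n : ℝ) / n) atTop (𝓝 0) ∧
      Tendsto (fun n : ℕ => (n : ℝ) * (T (L n) / L n)) atTop (𝓝 0) := by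
  -- With `L` about `n x`, the summand `1 / √n` forces `L ≥ √n`, so `T(L) ≤ T(√n)`; the other
  -- summand gives `n T(L) / L ≤ T(√n) / x ≤ √(T(√n))`.
  set x : ℕ → ℝ := fun n => √(T (Nat.sqrt n)) + 1 / √n with hx
  have hsqrt : Tendsto Nat.sqrt atTop atTop := by
    refine tendsto_atTop.2 fun m => ?_
    filter_upwards [eventually_ge_atTop (m * m)] with n hn
    exact Nat.le_sqrt.2 hn
  have hTs : Tendsto (fun n => √(T (Nat.sqrt n))) atTop (𝓝 0) := by
    simpa using (hT.comp hsqrt).sqrt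
  have hxs : Tendsto x atTop (𝓝 0) := by
    have : Tendsto (fun n : ℕ => 1 / √(n : ℝ)) atTop (𝓝 0) := by
      simp only [one_div]
      exact (Real.tendsto_sqrt_atTop.comp tendsto_natCast_atTop_atTop).inv_tendsto_atTop
    simpa only [add_zero] using hTs.add this
  have hx₀ : ∀ n, 0 ≤ x n := fun n =>
    add_nonneg (Real.sqrt_nonneg _) (one_div_nonneg.2 (Real.sqrt_nonneg _))
  refine ⟨fun n => ⌈n * x n⌉₊ + 1, fun n => Nat.le_add_left _ _, ?_, ?_⟩
  · have h2 : Tendsto (fun n : ℕ => x n + 2 / (n : ℝ)) atTop (𝓝 0) := by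
      simpa using hxs.add (tendsto_const_div_atTop_nhds_zero_nat (2 : ℝ))
    refine squeeze_zero' (Eventually.of_forall fun n => by positivity) ?_ h2
    filter_upwards [eventually_ge_atTop 1] with n hn
    have hn' : (0 : ℝ) < n := by exact_mod_cast hn
    have h := (Nat.ceil_lt_add_one (mul_nonneg hn'.le (hx₀ n))).le
    rw [div_le_iff₀ hn', add_mul, div_mul_cancel₀ _ hn'.ne']
    push_cast
    linarith
  · refine squeeze_zero' (Eventually.of_forall fun n => ?_) ?_ hTs
    · have := h₀ (⌈n * x n⌉₊ + 1)
      positivity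
    filter_upwards [eventually_ge_atTop 1] with n hn
    have hn' : (0 : ℝ) < n := by exact_mod_cast hn
    have hs : 0 < √(n : ℝ) := Real.sqrt_pos.2 hn'
    have hL : n * x n ≤ ((⌈n * x n⌉₊ + 1 : ℕ) : ℝ) := by
      push_cast
      linarith [Nat.le_ceil (n * x n)]
    have hLs : Nat.sqrt n ≤ ⌈n * x n⌉₊ + 1 := by
      have h₁ : (Nat.sqrt n : ℝ) ≤ √n := Real.nat_sqrt_le_real_sqrt
      have h₂ : √(n : ℝ) ≤ n * x n := by
        have : √(n : ℝ) = n * (1 / √n) := by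
          rw [mul_one_div, eq_div_iff hs.ne', Real.mul_self_sqrt hn'.le]
        calc √(n : ℝ) = n * (1 / √n) := this
          _ ≤ n * x n := by
            refine mul_le_mul_of_nonneg_left ?_ hn'.le
            simp only [hx]
            linarith [Real.sqrt_nonneg (T (Nat.sqrt n))]
      exact_mod_cast h₁.trans (h₂.trans hL)
    have hTL := hanti hLs
    have hxpos : 0 < x n := by
      have : 0 < 1 / √(n : ℝ) := by positivity
      simp only [hx]
      linarith [Real.sqrt_nonneg (T (Nat.sqrt n))]
    have hLpos : (0 : ℝ) < ((⌈n * x n⌉₊ + 1 : ℕ) : ℝ) := by positivity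
    rw [← mul_div_assoc, div_le_iff₀ hLpos]
    have hTx : T (Nat.sqrt n) ≤ √(T (Nat.sqrt n)) * x n := by
      calc T (Nat.sqrt n) = √(T (Nat.sqrt n)) * √(T (Nat.sqrt n)) :=
            (Real.mul_self_sqrt (h₀ _)).symm
        _ ≤ _ := by
          refine mul_le_mul_of_nonneg_left ?_ (Real.sqrt_nonneg _)
          simp only [hx]
          have : 0 ≤ 1 / √(n : ℝ) := by positivity
          linarith
    calc n * T (⌈n * x n⌉₊ + 1) ≤ n * (√(T (Nat.sqrt n)) * x n) :=
          mul_le_mul_of_nonneg_left (hTL.trans hTx) hn'.le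
      _ = √(T (Nat.sqrt n)) * (n * x n) := by ring
      _ ≤ _ := mul_le_mul_of_nonneg_left hL (Real.sqrt_nonneg _)

lemma exists_blocks {t : ℕ → ℕ} (ht : ∀ n, 1 ≤ t n)
    (htn : Tendsto (fun n : ℕ => (t n : ℝ) / n) atTop (𝓝 0)) :
    ∃ k : ℕ → ℕ, Tendsto k atTop atTop ∧
      Tendsto (fun n : ℕ => ((k n : ℝ) * t n) / n) atTop (𝓝 0) := by
  -- For `k = √(n / t)` one has `k² t ≤ n`, so `k t / n ≤ 1 / k`.
  have hk : Tendsto (fun n => Nat.sqrt (n / t n)) atTop atTop := by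
    refine tendsto_atTop.2 fun m => ?_
    have hpos : (0 : ℝ) < 1 / ((m : ℝ) * m + 1) := by positivity
    filter_upwards [htn.eventually (gt_mem_nhds hpos), eventually_ge_atTop 1] with n hn h1
    have hn' : (0 : ℝ) < n := by exact_mod_cast h1
    rw [Nat.le_sqrt, Nat.le_div_iff_mul_le (ht n)]
    rw [div_lt_div_iff₀ hn' (by positivity), one_mul] at hn
    have : ((m * m * t n : ℕ) : ℝ) ≤ n := by
      push_cast
      nlinarith [Nat.cast_nonneg (α := ℝ) (t n)]
    exact_mod_cast this
  refine ⟨_, hk, ?_⟩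
  have hinv : Tendsto (fun n => 1 / (Nat.sqrt (n / t n) : ℝ)) atTop (𝓝 0) := by
    simp only [one_div]
    exact (tendsto_natCast_atTop_atTop.comp hk).inv_tendsto_atTop
  refine squeeze_zero' (Eventually.of_forall fun n => by positivity) ?_ hinv
  filter_upwards [hk.eventually_ge_atTop 1, eventually_ge_atTop 1] with n hk1 h1
  have hn' : (0 : ℝ) < n := by exact_mod_cast h1
  have hk' : (0 : ℝ) < (Nat.sqrt (n / t n) : ℝ) := by exact_mod_cast hk1
  rw [div_le_div_iff₀ hn' hk', one_mul]
  have h : Nat.sqrt (n / t n) * t n * Nat.sqrt (n / t n) ≤ n := by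
    have h₁ := Nat.sqrt_le (n / t n)
    have h₂ := Nat.div_mul_le_self n (t n)
    calc _ = Nat.sqrt (n / t n) * Nat.sqrt (n / t n) * t n := by ring
      _ ≤ n / t n * t n := Nat.mul_le_mul_right _ h₁
      _ ≤ n := h₂
  exact_mod_cast h

lemma tendsto_of_tendsto_approx {x : ℕ → ℝ} {y e : ℕ → ℕ → ℝ} {Y E : ℕ → ℝ} {z : ℝ}
    (hxy : ∀ K, 1 ≤ K → ∀ᶠ n in atTop, |x n - y K n| ≤ e K n)
    (hy : ∀ K, 1 ≤ K → Tendsto (y K) atTop (𝓝 (Y K)))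
    (he : ∀ K, 1 ≤ K → Tendsto (e K) atTop (𝓝 (E K)))
    (hY : Tendsto Y atTop (𝓝 z)) (hE : Tendsto E atTop (𝓝 0)) : Tendsto x atTop (𝓝 z) := by
  rw [Metric.tendsto_nhds]
  intro η hη
  have hη4 : 0 < η / 4 := by linarith
  obtain ⟨K, hYK, hEK, hK⟩ := ((Metric.tendsto_nhds.1 hY _ hη4).and
    ((hE.eventually (gt_mem_nhds hη4)).and (eventually_ge_atTop 1))).exists
  filter_upwards [hxy K hK, Metric.tendsto_nhds.1 (hy K hK) _ hη4,
    (he K hK).eventually (gt_mem_nhds (show E K < η / 2 by linarith))] with n h₁ h₂ h₃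
  rw [Real.dist_eq] at *
  rw [abs_lt] at *
  rw [abs_le] at h₁
  constructor <;> linarith [h₁.1, h₁.2, h₂.1, h₂.2, hYK.1, hYK.2]

end Sequences

/-! ### Consequences of decay of correlations against `L¹` -/

section Decay

variable {X : Type*} [MeasurableSpace X] {μ : Measure X} [IsProbabilityMeasure μ] {f : X → X}

/-- Decorrelation of a bounded family of events from the future, with rate `r`. -/
lemma AssumptionA.exists_rate {φ : X → EReal} {q : ℕ} {u : ℕ → ℝ}
    (hμ : MeasurePreserving f μ μ) (hφ : Measurable φ)
    {C₁ : Type*} [NormedAddCommGroup C₁] [NormedSpace ℝ C₁] {toFun : C₁ →ₗ[ℝ] (X → ℝ)}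
    (hA : AssumptionA μ f φ q u toFun) :
    ∃ r : ℕ → ℝ, Summable r ∧ (∀ j, 0 ≤ r j) ∧ ∀ n, 1 ≤ n → ∀ E, MeasurableSet E → ∀ j, 1 ≤ j →
      |μ.real (escape f φ q (u n) ∩ f^[j] ⁻¹' E) - μ.real (escape f φ q (u n)) * μ.real E| ≤
        r j * μ.real E := by
  obtain ⟨⟨ρ, hρ, hdec⟩, C, hC, hind⟩ := hA
  refine ⟨fun j => |ρ j| * C, hρ.abs.mul_right C, fun j => by positivity, ?_⟩
  intro n hn E hE j hj
  obtain ⟨g, hg, hgC⟩ := hind n hn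
  have hAm := measurableSet_escape hμ.measurable hφ q (u n)
  have hEj : MeasurableSet (f^[j] ⁻¹' E) := (hμ.measurable.iterate j) hE
  obtain ⟨-, -, h⟩ := hdec g (E.indicator fun _ => (1 : ℝ))
    ((integrable_const (1 : ℝ)).indicator hE) j hj
  have h₁ : ∫ x, toFun g x * E.indicator (fun _ => (1 : ℝ)) (f^[j] x) ∂μ =
      μ.real (escape f φ q (u n) ∩ f^[j] ⁻¹' E) := by
    rw [← integral_indicator_one (hAm.inter hEj)]
    refine integral_congr_ae ?_
    filter_upwards [hg] with x hx
    rw [hx]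
    by_cases h₁ : x ∈ escape f φ q (u n) <;> by_cases h₂ : f^[j] x ∈ E <;>
      simp [h₁, h₂]
  have h₂ : ∫ x, toFun g x ∂μ = μ.real (escape f φ q (u n)) := by
    rw [← integral_indicator_one hAm]
    exact integral_congr_ae hg
  have h₃ : ∫ x, E.indicator (fun _ => (1 : ℝ)) x ∂μ = μ.real E := integral_indicator_one hE
  have h₄ : ∫ x, |E.indicator (fun _ => (1 : ℝ)) x| ∂μ = μ.real E := by
    rw [← h₃]
    congr 1
    ext x
    exact abs_of_nonneg (indicator_nonneg (fun _ _ => zero_le_one) x)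
  rw [h₁, h₂, h₃, h₄] at h
  refine h.trans ?_
  calc ρ j * (‖g‖ * μ.real E) ≤ |ρ j| * (C * μ.real E) := by
        refine mul_le_mul (le_abs_self _) ?_ (by positivity) (abs_nonneg _)
        exact mul_le_mul_of_nonneg_right hgC measureReal_nonneg
    _ = _ := by ring

variable {A : Set X} {r : ℕ → ℝ}

omit [IsProbabilityMeasure μ] in
/-- The total probability of returns in a time window, when there are none before time `R`. -/
lemma sum_real_return_le (hA : MeasurableSet A) (hr : Summable r) (h₀ : ∀ j, 0 ≤ r j)
    (hdec : ∀ E, MeasurableSet E → ∀ j, 1 ≤ j →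
      |μ.real (A ∩ f^[j] ⁻¹' E) - μ.real A * μ.real E| ≤ r j * μ.real E)
    {R : ℕ} (hR : ∀ j, 1 ≤ j → j < R → A ∩ f^[j] ⁻¹' A = ∅) {s : ℕ} (hs : 1 ≤ s) (m : ℕ) :
    ∑ j ∈ Finset.Ico s (s + m), μ.real (A ∩ f^[j] ⁻¹' A) ≤
      m * μ.real A ^ 2 + μ.real A * ∑' j, r (j + R) := by
  classical
  have hj : ∀ j ∈ Finset.Ico s (s + m), μ.real (A ∩ f^[j] ⁻¹' A) ≤
      μ.real A ^ 2 + μ.real A * (if R ≤ j then r j else 0) := by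
    intro j hj
    have hj1 : 1 ≤ j := hs.trans (Finset.mem_Ico.1 hj).1
    split_ifs with h
    -- Decay against `L¹` makes the error proportional to `μ(A)`; without this factor,
    -- multiplication by `n` would destroy the bound.
    · have := (abs_le.1 (hdec A hA j hj1)).2
      nlinarith
    · rw [hR j hj1 (not_le.1 h)]
      simp
  refine (Finset.sum_le_sum hj).trans ?_
  rw [Finset.sum_add_distrib, ← Finset.mul_sum, ← Finset.sum_filter]
  simp only [Finset.sum_const, Nat.card_Ico, nsmul_eq_mul, Nat.add_sub_cancel_left]
  have := sum_le_tsum_add hr h₀ (m := R) (I := {j ∈ Finset.Ico s (s + m) | R ≤ j})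
    fun j hj => (Finset.mem_filter.1 hj).2
  have := mul_le_mul_of_nonneg_left this (measureReal_nonneg (μ := μ) (s := A))
  linarith

/-- The dependence between `A` and the absence of visits to `A` during a later time window, however
soon the window begins. -/
lemma abs_real_inter_noHit_sub_mul_le (hμ : MeasurePreserving f μ μ) (hA : MeasurableSet A)
    (hr : Summable r) (h₀ : ∀ j, 0 ≤ r j)
    (hdec : ∀ E, MeasurableSet E → ∀ j, 1 ≤ j →
      |μ.real (A ∩ f^[j] ⁻¹' E) - μ.real A * μ.real E| ≤ r j * μ.real E)
    {R : ℕ} (hR : ∀ j, 1 ≤ j → j < R → A ∩ f^[j] ⁻¹' A = ∅) {L : ℕ} (hL : 1 ≤ L)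
    {s : ℕ} (hs : 1 ≤ s) (l : ℕ) :
    |μ.real (A ∩ f^[s] ⁻¹' noHit f A l) - μ.real A * μ.real (noHit f A l)| ≤
      (∑' j, r (j + L)) / L + 2 * (2 * L * μ.real A ^ 2 + μ.real A * ∑' j, r (j + R)) := by
  have hL' : (0 : ℝ) < L := by exact_mod_cast hL
  -- The rate is summable but not assumed monotone, so a good gap is found by averaging over `L`
  -- consecutive times beyond `L`.
  obtain ⟨t, ht, hrt⟩ : ∃ t ∈ Finset.Ico (s + L) (s + L + L), r t ≤ (∑' j, r (j + L)) / L := by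
    refine Finset.exists_le_of_sum_le ⟨s + L, by simp; omega⟩ ?_
    refine (sum_le_tsum_add hr h₀ (m := L) fun j hj => ?_).trans (le_of_eq ?_)
    · have := Finset.mem_Ico.1 hj
      omega
    · simp only [Finset.sum_const, Nat.card_Ico, Nat.add_sub_cancel_left, nsmul_eq_mul]
      field_simp
  rw [Finset.mem_Ico] at ht
  have h₁ := abs_real_inter_preimage_noHit_sub_le (μ := μ) (f := f) (B := A)
    (show s ≤ t by omega) l
  have h₂ := hdec _ (measurableSet_noHit hμ.measurable hA l) t (by omega)
  have h₃ : r t * μ.real (noHit f A l) ≤ r t := mul_le_of_le_one_right (h₀ t) measureReal_le_one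
  have h₄ := sum_real_return_le hA hr h₀ hdec hR hs (t - s)
  have h₅ := sum_real_return_le hA hr h₀ hdec hR (show 1 ≤ s + l by omega) (t - s)
  rw [show s + (t - s) = t by omega] at h₄
  rw [show s + l + (t - s) = t + l by omega] at h₅
  have h₆ : ((t - s : ℕ) : ℝ) * μ.real A ^ 2 ≤ 2 * L * μ.real A ^ 2 := by
    refine mul_le_mul_of_nonneg_right ?_ (by positivity)
    exact_mod_cast (by omega : t - s ≤ 2 * L)
  calc _ ≤ |μ.real (A ∩ f^[s] ⁻¹' noHit f A l) - μ.real (A ∩ f^[t] ⁻¹' noHit f A l)| +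
        |μ.real (A ∩ f^[t] ⁻¹' noHit f A l) - μ.real A * μ.real (noHit f A l)| :=
        abs_sub_le _ _ _
    _ ≤ _ := by linarith

/-- The recursion for the avoidance probability is that of the power up to an error `b`, and the
factor `1 - μ(A)` does not amplify earlier errors. -/
lemma abs_real_noHit_sub_pow_le (hμ : MeasurePreserving f μ μ) (hA : MeasurableSet A) {b : ℝ}
    (hb : ∀ l, |μ.real (A ∩ f^[1] ⁻¹' noHit f A l) - μ.real A * μ.real (noHit f A l)| ≤ b)
    (l : ℕ) : |μ.real (noHit f A l) - (1 - μ.real A) ^ l| ≤ l * b := by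
  induction l with
  | zero => simp [noHit_zero]
  | succ l ih =>
    have h₁ := real_noHit_sub_succ hμ hA l
    have h₂ := hb l
    rw [Function.iterate_one] at h₂
    have h₃ : |1 - μ.real A| ≤ 1 := by
      rw [abs_le]
      constructor <;> linarith [measureReal_nonneg (μ := μ) (s := A),
        measureReal_le_one (μ := μ) (s := A)]
    have h₄ : μ.real (noHit f A (l + 1)) - (1 - μ.real A) ^ (l + 1) =
        (1 - μ.real A) * (μ.real (noHit f A l) - (1 - μ.real A) ^ l) -
          (μ.real (A ∩ f ⁻¹' noHit f A l) - μ.real A * μ.real (noHit f A l)) := by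
      rw [pow_succ]
      linarith
    rw [h₄]
    refine (abs_sub _ _).trans ?_
    rw [abs_mul]
    have h₅ := mul_le_of_le_one_left (abs_nonneg (μ.real (noHit f A l) - (1 - μ.real A) ^ l)) h₃
    push_cast
    linarith

end Decay

/-! ### Conditions `D` and `D'`, extremal index, limit law -/

section Limit

variable {X : Type*} [MeasurableSpace X] {μ : Measure X} [IsProbabilityMeasure μ] {f : X → X}
  {φ : X → EReal} {q : ℕ} {u : ℕ → ℝ} {τ : ℝ}

lemma exists_error_bounds (hμ : MeasurePreserving f μ μ) (hφ : Measurable φ)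
    (hu : IsNormalising μ φ u τ)
    {C₁ : Type*} [NormedAddCommGroup C₁] [NormedSpace ℝ C₁] {toFun : C₁ →ₗ[ℝ] (X → ℝ)}
    (hA : AssumptionA μ f φ q u toFun)
    (hshort : ∀ j, 0 < j →
      ∀ᶠ n in atTop, escape f φ q (u n) ∩ f^[j] ⁻¹' escape f φ q (u n) = ∅) :
    ∃ e b : ℕ → ℝ, Tendsto (fun n : ℕ => (n : ℝ) * e n) atTop (𝓝 0) ∧
      Tendsto (fun n : ℕ => (n : ℝ) * b n) atTop (𝓝 0) ∧ (∀ n, 0 ≤ b n) ∧ ∀ n, 1 ≤ n →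
        (∀ m : ℕ, ∑ j ∈ Finset.Ico 1 m, μ.real (escape f φ q (u n) ∩
          f^[j] ⁻¹' escape f φ q (u n)) ≤ m * μ.real (exceed φ (u n)) ^ 2 + e n) ∧
        ∀ s, 1 ≤ s → ∀ l, |μ.real (escape f φ q (u n) ∩ f^[s] ⁻¹' noHit f (escape f φ q (u n)) l) -
          μ.real (escape f φ q (u n)) * μ.real (noHit f (escape f φ q (u n)) l)| ≤ b n := by
  obtain ⟨r, hr, hr₀, hdec⟩ := hA.exists_rate hμ hφ
  -- Each fixed return time is excluded only eventually; diagonalising excludes all times below some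
  -- `R n → ∞`.
  obtain ⟨R, hR, hRn⟩ := exists_tendsto_atTop_forall
    (P := fun J n => ∀ j, 1 ≤ j → j < J → escape f φ q (u n) ∩ f^[j] ⁻¹' escape f φ q (u n) = ∅)
    (fun n j _ hj => absurd hj (Nat.not_lt_zero j)) (fun J => by
      have : ∀ᶠ n in atTop, ∀ j ∈ Finset.Ico 1 J,
          escape f φ q (u n) ∩ f^[j] ⁻¹' escape f φ q (u n) = ∅ :=
        (Finset.eventually_all _).2 fun j hj => hshort j (Finset.mem_Ico.1 hj).1
      filter_upwards [this] with n hn j h₁ h₂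
      exact hn j (Finset.mem_Ico.2 ⟨h₁, h₂⟩))
  have hT : Tendsto (fun m => ∑' j, r (j + m)) atTop (𝓝 0) := tendsto_sum_nat_add r
  have hT₀ : ∀ m, 0 ≤ ∑' j, r (j + m) := fun m => tsum_nonneg fun j => hr₀ _
  have hTanti : Antitone fun m => ∑' j, r (j + m) := by
    refine antitone_nat_of_succ_le fun m => ?_
    have h := ((summable_nat_add_iff m).2 hr).tsum_eq_zero_add
    simp only [h, zero_add]
    simp only [add_right_comm _ 1 m, add_assoc]
    linarith [hr₀ m]
  obtain ⟨L, hL1, hL, hLT⟩ := exists_scale hT₀ hTanti hT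
  set a : ℕ → ℝ := fun n => μ.real (exceed φ (u n)) with ha
  have hu' : Tendsto (fun n : ℕ => (n : ℝ) * a n) atTop (𝓝 τ) := hu
  have he : Tendsto (fun n : ℕ => (n : ℝ) * (a n * ∑' j, r (j + R n))) atTop (𝓝 0) := by
    have := hu'.mul (hT.comp hR)
    rw [mul_zero] at this
    exact this.congr fun n => mul_assoc _ _ _
  have ha₀ : ∀ n, 0 ≤ a n := fun n => measureReal_nonneg
  have hle : ∀ n, μ.real (escape f φ q (u n)) ≤ a n := fun n => measureReal_mono inter_subset_left
  have hsq : ∀ n, μ.real (escape f φ q (u n)) ^ 2 ≤ a n ^ 2 := fun n =>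
    pow_le_pow_left₀ measureReal_nonneg (hle n) 2
  have hAm := fun n => measurableSet_escape hμ.measurable hφ q (u n)
  refine ⟨fun n => a n * ∑' j, r (j + R n), fun n => (∑' j, r (j + L n)) / L n +
    2 * (2 * L n * a n ^ 2 + a n * ∑' j, r (j + R n)), he, ?_, fun n => ?_,
    fun n hn => ⟨fun m => ?_, fun s hs l => ?_⟩⟩
  · have h₁ := (hL.mul (hu'.mul hu')).const_mul 4
    have h₂ := hLT.add (h₁.add (he.const_mul 2))
    simp only [zero_mul, mul_zero, add_zero] at h₂
    refine h₂.congr' ?_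
    filter_upwards [eventually_ge_atTop 1] with n hn
    have hn' : (n : ℝ) ≠ 0 := by positivity
    field_simp
    ring
  · have := hT₀ (L n)
    have := hT₀ (R n)
    have := ha₀ n
    positivity
  · have h := sum_real_return_le (hAm n) hr hr₀ (hdec n hn) (hRn n) le_rfl m
    have hsub : ∑ j ∈ Finset.Ico 1 m, μ.real (escape f φ q (u n) ∩
        f^[j] ⁻¹' escape f φ q (u n)) ≤ ∑ j ∈ Finset.Ico 1 (1 + m),
          μ.real (escape f φ q (u n) ∩ f^[j] ⁻¹' escape f φ q (u n)) :=
      Finset.sum_le_sum_of_subset_of_nonneg (Finset.Ico_subset_Ico_right (by omega))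
        fun _ _ _ => measureReal_nonneg
    have h₁ := mul_le_mul_of_nonneg_left (hsq n) (Nat.cast_nonneg (α := ℝ) m)
    have h₂ := mul_le_mul_of_nonneg_right (hle n) (hT₀ (R n))
    simp only [ha] at *
    linarith
  · have h := abs_real_inter_noHit_sub_mul_le hμ (hAm n) hr hr₀ (hdec n hn) (hRn n) (hL1 n) hs l
    have h₁ := mul_le_mul_of_nonneg_left (hsq n) (Nat.cast_nonneg (α := ℝ) (L n))
    have h₂ := mul_le_mul_of_nonneg_right (hle n) (hT₀ (R n))
    linarith

lemma condD_of_bounds {b : ℕ → ℝ} (hb : Tendsto (fun n : ℕ => (n : ℝ) * b n) atTop (𝓝 0))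
    (hb₀ : ∀ n, 0 ≤ b n)
    (h : ∀ n, 1 ≤ n → ∀ s, 1 ≤ s → ∀ l,
      |μ.real (escape f φ q (u n) ∩ f^[s] ⁻¹' noHit f (escape f φ q (u n)) l) -
        μ.real (escape f φ q (u n)) * μ.real (noHit f (escape f φ q (u n)) l)| ≤ b n) :
    CondD μ f φ q u fun _ => 1 := by
  -- The estimate requires `n ≥ 1` and gap `s ≥ 1`. Elsewhere `1` is a trivial bound, and adding `b
  -- n` keeps `γ` nonincreasing in the gap.
  refine ⟨fun _ => le_rfl, ?_, fun n s => if n = 0 ∨ s = 0 then 1 + b n else b n, ?_, ?_, ?_⟩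
  · simpa using tendsto_const_div_atTop_nhds_zero_nat (1 : ℝ)
  · intro n s t hst
    dsimp only
    split_ifs with h₁ h₂ h₂
    · exact le_rfl
    · omega
    · linarith
    · exact le_rfl
  · refine hb.congr' ?_
    filter_upwards [eventually_ge_atTop 1] with n hn
    have : ¬ (n = 0 ∨ 1 = 0) := by omega
    simp only [if_neg this]
  · intro l s n
    rw [avoid_eq_preimage_noHit, avoid_eq_preimage_noHit, Function.iterate_zero, preimage_id]
    dsimp only
    split_ifs with h₁
    · have h₂ := measureReal_nonneg (μ := μ)
        (s := escape f φ q (u n) ∩ f^[s] ⁻¹' noHit f (escape f φ q (u n)) (l - 1 + 1))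
      have h₃ := measureReal_le_one (μ := μ)
        (s := escape f φ q (u n) ∩ f^[s] ⁻¹' noHit f (escape f φ q (u n)) (l - 1 + 1))
      have h₄ : 0 ≤ μ.real (escape f φ q (u n)) *
          μ.real (noHit f (escape f φ q (u n)) (l - 1 + 1)) := by positivity
      have h₅ : μ.real (escape f φ q (u n)) *
          μ.real (noHit f (escape f φ q (u n)) (l - 1 + 1)) ≤ 1 :=
        mul_le_one₀ measureReal_le_one measureReal_nonneg measureReal_le_one
      rw [abs_le]
      constructor <;> linarith [hb₀ n]
    · exact h n (by omega) s (by omega) _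

omit [IsProbabilityMeasure μ] in
-- Restricting to times below `n / k n` leaves the bound `(n μ(U_n))² / k n + n e n`, which vanishes
-- as `k n → ∞`.
lemma condD'_of_bounds (hu : IsNormalising μ φ u τ) {e : ℕ → ℝ}
    (he : Tendsto (fun n : ℕ => (n : ℝ) * e n) atTop (𝓝 0))
    (h : ∀ n, 1 ≤ n → ∀ m : ℕ, ∑ j ∈ Finset.Ico 1 m, μ.real (escape f φ q (u n) ∩
      f^[j] ⁻¹' escape f φ q (u n)) ≤ m * μ.real (exceed φ (u n)) ^ 2 + e n)
    {t : ℕ → ℕ} (ht : ∀ n, 1 ≤ t n) (htn : Tendsto (fun n : ℕ => (t n : ℝ) / n) atTop (𝓝 0)) :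
    CondD' μ f φ q u t := by
  obtain ⟨k, hk, hkt⟩ := exists_blocks ht htn
  refine ⟨k, hk, hkt, ?_⟩
  have hlim : Tendsto (fun n : ℕ => ((n : ℝ) * μ.real (exceed φ (u n))) ^ 2 / k n + n * e n)
      atTop (𝓝 0) := by
    simpa using ((Tendsto.pow hu 2).div_atTop (tendsto_natCast_atTop_atTop.comp hk)).add he
  refine squeeze_zero' (Eventually.of_forall fun n => ?_) ?_ hlim
  · exact mul_nonneg (Nat.cast_nonneg _) (Finset.sum_nonneg fun _ _ => measureReal_nonneg)
  filter_upwards [eventually_ge_atTop 1] with n hn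
  have h₁ : ∑ j ∈ Finset.Ico (q + 1) (n / k n), μ.real (escape f φ q (u n) ∩
      f^[j] ⁻¹' escape f φ q (u n)) ≤ ∑ j ∈ Finset.Ico 1 (n / k n), μ.real (escape f φ q (u n) ∩
      f^[j] ⁻¹' escape f φ q (u n)) :=
    Finset.sum_le_sum_of_subset_of_nonneg (Finset.Ico_subset_Ico_left (by omega))
      fun _ _ _ => measureReal_nonneg
  have h₂ := h n hn (n / k n)
  have h₃ : ((n / k n : ℕ) : ℝ) * μ.real (exceed φ (u n)) ^ 2 ≤
      n / k n * μ.real (exceed φ (u n)) ^ 2 :=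
    mul_le_mul_of_nonneg_right Nat.cast_div_le (sq_nonneg _)
  calc _ ≤ (n : ℝ) * (n / k n * μ.real (exceed φ (u n)) ^ 2 + e n) :=
        mul_le_mul_of_nonneg_left (by linarith) (Nat.cast_nonneg _)
    _ = _ := by ring

lemma tendsto_mul_one_sub_exp (c : ℝ) :
    Tendsto (fun K : ℕ => (K : ℝ) * (1 - Real.exp (-(c / K)))) atTop (𝓝 c) := by
  have hd : HasDerivAt (fun s : ℝ => 1 - Real.exp (-(c * s))) c 0 := by
    have h := ((((hasDerivAt_id (0 : ℝ)).const_mul c).neg).exp).const_sub 1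
    simpa using h
  have h := hd.tendsto_slope_zero_right.comp
    (tendsto_inv_atTop_nhdsGT_zero.comp (tendsto_natCast_atTop_atTop (R := ℝ)))
  refine h.congr fun K => ?_
  simp [div_eq_mul_inv]

lemma tendsto_natDiv_mul {K : ℕ} (hK : 1 ≤ K) {x : ℕ → ℝ} {c : ℝ} (hx₀ : Tendsto x atTop (𝓝 0))
    (hx : Tendsto (fun n : ℕ => (n : ℝ) * x n) atTop (𝓝 c)) :
    Tendsto (fun n : ℕ => ((n / K : ℕ) : ℝ) * x n) atTop (𝓝 (c / K)) := by
  have hK' : (0 : ℝ) < K := by exact_mod_cast hK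
  have h : Tendsto (fun n : ℕ => (n : ℝ) / K * x n - ((n / K : ℕ) : ℝ) * x n) atTop (𝓝 0) := by
    refine squeeze_zero_norm (fun n => ?_) (by simpa using hx₀.abs)
    have h₁ : ((n / K : ℕ) : ℝ) ≤ n / K := Nat.cast_div_le
    have h₂ : (n : ℝ) / K ≤ (n / K : ℕ) + 1 := by
      rw [div_le_iff₀ hK']
      exact_mod_cast (by
        have := Nat.div_add_mod n K
        have := Nat.mod_lt n hK
        nlinarith : n ≤ (n / K + 1) * K)
    rw [← sub_mul, Real.norm_eq_abs, abs_mul, abs_of_nonneg (by linarith)]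
    exact mul_le_of_le_one_left (abs_nonneg _) (by linarith)
  have h' := (hx.div_const (K : ℝ)).sub h
  rw [sub_zero] at h'
  exact h'.congr fun n => by ring

/-- Levels with the same normalisation produce the same limit law. -/
lemma tendsto_real_noHit_of_levels (hμ : MeasurePreserving f μ μ) (hφ : Measurable φ)
    {v w : ℕ → ℝ} {m : ℕ → ℕ} {σ z : ℝ}
    (hv : Tendsto (fun n => (m n : ℝ) * μ.real (exceed φ (v n))) atTop (𝓝 σ))
    (hw : Tendsto (fun n => (m n : ℝ) * μ.real (exceed φ (w n))) atTop (𝓝 σ))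
    (h : Tendsto (fun n => μ.real (noHit f (exceed φ (v n)) (m n))) atTop (𝓝 z)) :
    Tendsto (fun n => μ.real (noHit f (exceed φ (w n)) (m n))) atTop (𝓝 z) := by
  have h₀ : Tendsto (fun n => μ.real (noHit f (exceed φ (w n)) (m n)) -
      μ.real (noHit f (exceed φ (v n)) (m n))) atTop (𝓝 0) := by
    refine squeeze_zero_norm (fun n => abs_real_noHit_sub_le_of_total hμ
      (measurableSet_exceed hφ (v n)) (measurableSet_exceed hφ (w n))
      (exceed_total φ (w n) (v n)) (m n)) ?_
    simpa using (hv.sub hw).abs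
  simpa using h₀.add h

lemma tendsto_real_noHit_escape (hμ : MeasurePreserving f μ μ) (hφ : Measurable φ)
    {m : ℕ → ℕ} {z : ℝ} (hu₀ : Tendsto (fun n => μ.real (exceed φ (u n))) atTop (𝓝 0)) :
    Tendsto (fun n => μ.real (noHit f (escape f φ q (u n)) (m n))) atTop (𝓝 z) ↔
      Tendsto (fun n => μ.real (noHit f (exceed φ (u n)) (m n))) atTop (𝓝 z) := by
  have h₀ : Tendsto (fun n => μ.real (noHit f (escape f φ q (u n)) (m n)) -
      μ.real (noHit f (exceed φ (u n)) (m n))) atTop (𝓝 0) := by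
    refine squeeze_zero_norm (fun n => abs_real_noHit_escape_sub_le hμ
      (measurableSet_exceed hφ (u n)) q (m n)) ?_
    simpa using hu₀.const_mul (q : ℝ)
  exact ⟨fun h => by simpa using h.sub h₀, fun h => by simpa using h₀.add h⟩

/-- If clusters of returns are negligible, the extremal index is the asymptotic proportion of
exceedances that escape. -/
lemma HasExtremalIndex.tendsto_escape {ϑ s T : ℝ} (hμ : MeasurePreserving f μ μ)
    (hφ : Measurable φ) (hϑ : HasExtremalIndex μ f φ ϑ) (hs : 0 < s)
    (hu : IsNormalising μ φ u s) {a e : ℕ → ℝ}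
    (ha : Tendsto (fun n : ℕ => (n : ℝ) * a n) atTop (𝓝 T))
    (he : Tendsto (fun n : ℕ => (n : ℝ) * e n) atTop (𝓝 0))
    (h : ∀ᶠ n in atTop, ∀ m : ℕ, ∑ j ∈ Finset.Ico 1 m, μ.real (escape f φ q (u n) ∩
      f^[j] ⁻¹' escape f φ q (u n)) ≤ m * a n ^ 2 + e n) :
    Tendsto (fun n : ℕ => (n : ℝ) * μ.real (escape f φ q (u n))) atTop (𝓝 (ϑ * s)) := by
  have hu₀ := hu.tendsto_zero
  have hE : Tendsto (fun K : ℕ => T ^ 2 / (K : ℝ)) atTop (𝓝 0) :=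
    tendsto_const_div_atTop_nhds_zero_nat _
  refine tendsto_of_tendsto_approx
    (y := fun K n => K * (1 - μ.real (noHit f (escape f φ q (u n)) (n / K))))
    -- The first term is the rounding in `n / K`; the other two bound `n` times the returns inside
    -- one block. The limit `T² / K` in `n` disappears only as `K → ∞`.
    (e := fun K n => K * μ.real (exceed φ (u n)) + (n * a n) ^ 2 / K + n * e n)
    ?_ ?_ ?_ (tendsto_mul_one_sub_exp (ϑ * s)) hE
  · intro K hK
    filter_upwards [h] with n hn
    have hAm := measurableSet_escape hμ.measurable hφ q (u n)
    have h₁ := one_sub_real_noHit_le hμ hAm (n / K)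
    have h₂ := le_one_sub_real_noHit hμ hAm (le_refl (n / K))
    have h₃ := hn (n / K)
    have h₄ : μ.real (escape f φ q (u n)) ≤ μ.real (exceed φ (u n)) :=
      measureReal_mono inter_subset_left
    have h₅ : (0 : ℝ) ≤ μ.real (escape f φ q (u n)) := measureReal_nonneg
    have h₆ : 0 ≤ ∑ j ∈ Finset.Ico 1 (n / K), μ.real (escape f φ q (u n) ∩
      f^[j] ⁻¹' escape f φ q (u n)) := Finset.sum_nonneg fun _ _ => measureReal_nonneg
    have hK' : (0 : ℝ) < K := by exact_mod_cast hK
    have hm₁ : (K : ℝ) * (n / K : ℕ) ≤ n := by exact_mod_cast Nat.mul_div_le n K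
    have hm₂ : (n : ℝ) ≤ K * (n / K : ℕ) + K := by
      exact_mod_cast (by
        have := Nat.div_add_mod n K
        have := Nat.mod_lt n hK
        omega : n ≤ K * (n / K) + K)
    have hm₃ : ((n / K : ℕ) : ℝ) ≤ n / K := Nat.cast_div_le
    set p := μ.real (escape f φ q (u n))
    set w := μ.real (noHit f (escape f φ q (u n)) (n / K))
    set S := ∑ j ∈ Finset.Ico 1 (n / K), μ.real (escape f φ q (u n) ∩
      f^[j] ⁻¹' escape f φ q (u n))
    set m : ℝ := ((n / K : ℕ) : ℝ)
    have h₇ : K * (1 - w) ≤ K * (m * p) := mul_le_mul_of_nonneg_left h₁ hK'.le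
    have h₈ : K * (m * (p - S)) ≤ K * (1 - w) := mul_le_mul_of_nonneg_left h₂ hK'.le
    have h₉ : K * m * p ≤ n * p := mul_le_mul_of_nonneg_right hm₁ h₅
    have h₁₀ : n * p ≤ (K * m + K) * p := mul_le_mul_of_nonneg_right hm₂ h₅
    have h₁₁ : K * m * S ≤ n * S := mul_le_mul_of_nonneg_right hm₁ h₆
    have h₁₂ : n * S ≤ n * (n / K * a n ^ 2 + e n) := by
      refine mul_le_mul_of_nonneg_left (h₃.trans ?_) (Nat.cast_nonneg _)
      have := mul_le_mul_of_nonneg_right hm₃ (sq_nonneg (a n))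
      linarith
    have h₁₃ : K * p ≤ K * μ.real (exceed φ (u n)) := mul_le_mul_of_nonneg_left h₄ hK'.le
    have h₁₄ : n * (n / K * a n ^ 2 + e n) = (n * a n) ^ 2 / K + n * e n := by ring
    rw [abs_of_nonneg (by linarith)]
    linarith
  · intro K hK
    have hK' : (0 : ℝ) < K := by exact_mod_cast hK
    obtain ⟨v, hv, hlaw⟩ := hϑ (s / K) (div_pos hs hK')
    have hdiv : Tendsto (fun n : ℕ => n / K) atTop atTop := by
      refine tendsto_atTop.2 fun m => ?_
      filter_upwards [eventually_ge_atTop (m * K)] with n hn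
      exact (Nat.le_div_iff_mul_le hK).2 hn
    simp only [setOf_partialMax_le] at hlaw
    -- At time `n / K` the levels `u n` have parameter `s / K`, as do the levels `v (n / K)`
    -- supplied by the extremal index, so the law passes from `v` to `u`.
    have h₁ := tendsto_real_noHit_of_levels (f := f) hμ hφ (v := fun n => v (n / K)) (w := u)
      (m := fun n => n / K) (Tendsto.comp hv hdiv) (tendsto_natDiv_mul hK hu₀ hu)
      (hlaw.comp hdiv)
    have h₂ := (tendsto_real_noHit_escape (q := q) hμ hφ hu₀).2 h₁
    simpa only [mul_div_assoc] using (h₂.const_sub 1).const_mul (K : ℝ)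
  · intro K hK
    simpa using ((hu₀.const_mul (K : ℝ)).add ((ha.pow 2).div_const (K : ℝ))).add he

/-- The extreme value law in terms of the asymptotic frequency of escapes. -/
lemma tendsto_partialMax_of_bounds (hμ : MeasurePreserving f μ μ) (hφ : Measurable φ)
    (hu : IsNormalising μ φ u τ) {b : ℕ → ℝ} {c : ℝ}
    (hb : Tendsto (fun n : ℕ => (n : ℝ) * b n) atTop (𝓝 0))
    (h : ∀ n, 1 ≤ n → ∀ l,
      |μ.real (escape f φ q (u n) ∩ f^[1] ⁻¹' noHit f (escape f φ q (u n)) l) -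
        μ.real (escape f φ q (u n)) * μ.real (noHit f (escape f φ q (u n)) l)| ≤ b n)
    (hc : Tendsto (fun n : ℕ => (n : ℝ) * μ.real (escape f φ q (u n))) atTop (𝓝 c)) :
    Tendsto (fun n : ℕ => μ.real {x | partialMax f φ n x ≤ (u n : EReal)}) atTop
      (𝓝 (Real.exp (-c))) := by
  simp only [setOf_partialMax_le]
  refine (tendsto_real_noHit_escape (q := q) (m := fun n => n) hμ hφ hu.tendsto_zero).1 ?_
  have h₁ : Tendsto (fun n : ℕ => (1 - μ.real (escape f φ q (u n))) ^ n) atTop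
      (𝓝 (Real.exp (-c))) := by
    refine (Real.tendsto_one_add_pow_exp_of_tendsto
      (g := fun n => -μ.real (escape f φ q (u n))) ?_).congr fun n => by rw [sub_eq_add_neg]
    simpa using hc.neg
  have h₂ : Tendsto (fun n : ℕ => μ.real (noHit f (escape f φ q (u n)) n) -
      (1 - μ.real (escape f φ q (u n))) ^ n) atTop (𝓝 0) := by
    refine squeeze_zero_norm' ?_ hb
    filter_upwards [eventually_ge_atTop 1] with n hn
    exact abs_real_noHit_sub_pow_le hμ (measurableSet_escape hμ.measurable hφ q (u n)) (h n hn) n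
  simpa using h₂.add h₁

end Limit

/-! ### Contribution of each peak and conclusion -/

lemma tendsto_escape_inter_ball {X : Type*} [MetricSpace X] [MeasurableSpace X] [BorelSpace X]
    {μ : Measure X} [IsProbabilityMeasure μ] {f : X → X} {φ : X → EReal} {N : ℕ} {ξ : Fin N → X}
    {uF : EReal} {δ : Fin N → ℝ} {ε : Fin N → ℝ → ℝ} {u : ℕ → ℝ} {τ ϑ a : ℝ} {q : ℕ}
    (hf : Continuous f) (hμ : MeasurePreserving f μ μ) (hφ : Measurable φ)
    (hmax : HasMaximalPoints μ φ ξ uF δ ε)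
    (horbit : Pairwise fun i j => Disjoint (orbit f (ξ i)) (orbit f (ξ j)))
    (hlev : Tendsto u atTop (levels uF)) (i : Fin N)
    (hϑ : HasExtremalIndex μ f (localised φ (Metric.ball (ξ i) (δ i))) ϑ)
    (hu : IsNormalising μ φ u τ)
    (ha : Tendsto (fun n : ℕ => μ.real (exceed φ (u n) ∩ Metric.ball (ξ i) (δ i)) /
      μ.real (exceed φ (u n))) atTop (𝓝 a))
    {e : ℕ → ℝ} (he : Tendsto (fun n : ℕ => (n : ℝ) * e n) atTop (𝓝 0))
    (h : ∀ n, 1 ≤ n → ∀ m : ℕ, ∑ j ∈ Finset.Ico 1 m, μ.real (escape f φ q (u n) ∩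
      f^[j] ⁻¹' escape f φ q (u n)) ≤ m * μ.real (exceed φ (u n)) ^ 2 + e n) :
    Tendsto (fun n : ℕ => (n : ℝ) * μ.real (escape f φ q (u n) ∩ Metric.ball (ξ i) (δ i))) atTop
      (𝓝 (ϑ * (τ * a))) := by
  have hle : ∀ n, μ.real (exceed φ (u n) ∩ Metric.ball (ξ i) (δ i)) ≤ μ.real (exceed φ (u n)) :=
    fun n => measureReal_mono inter_subset_left
  have hnorm : Tendsto (fun n : ℕ => (n : ℝ) *
      μ.real (exceed φ (u n) ∩ Metric.ball (ξ i) (δ i))) atTop (𝓝 (τ * a)) := by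
    refine (Tendsto.mul hu ha).congr fun n => ?_
    rw [mul_assoc, mul_div_cancel_of_imp']
    intro h₀
    exact le_antisymm (h₀ ▸ hle n) measureReal_nonneg
  have hesc := eventually_escape_localised hf hmax horbit hlev q i
  have hpos : 0 ≤ τ * a :=
    ge_of_tendsto' hnorm fun n => mul_nonneg (Nat.cast_nonneg _) measureReal_nonneg
  -- The extremal index speaks only of positive parameters; a peak of asymptotically zero weight
  -- contributes nothing anyway.
  rcases hpos.eq_or_lt with h₀ | hpos
  · rw [← h₀, mul_zero]
    refine squeeze_zero (fun n => mul_nonneg (Nat.cast_nonneg _) measureReal_nonneg) (fun n => ?_)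
      (h₀ ▸ hnorm)
    refine mul_le_mul_of_nonneg_left (measureReal_mono ?_) (Nat.cast_nonneg _)
    exact inter_subset_inter_left _ inter_subset_left
  · have hnorm' : IsNormalising μ (localised φ (Metric.ball (ξ i) (δ i))) u (τ * a) := by
      simpa only [IsNormalising, exceed_localised] using hnorm
    refine (hϑ.tendsto_escape (q := q) hμ (measurable_localised hφ measurableSet_ball) hpos hnorm'
      hu he ?_).congr' ?_
    · filter_upwards [hesc, eventually_ge_atTop 1] with n hn hn1 m
      -- Decay is not assumed for the localised events; their returns are controlled because they
      -- are also returns of the full escape event.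
      refine (Finset.sum_le_sum fun j _ => measureReal_mono ?_).trans (h n hn1 m)
      rw [hn]
      exact inter_subset_inter inter_subset_left (preimage_mono inter_subset_left)
    · filter_upwards [hesc] with n hn
      rw [hn]

end MultipleMaxima

open MultipleMaxima
theorem mainTheorem6 {X : Type*} [MetricSpace X] [MeasurableSpace X] [BorelSpace X]
    (μ : Measure X) [IsProbabilityMeasure μ]
    (f : X → X) (hf : Continuous f) (hμ : MeasurePreserving f μ μ)
    (φ : X → EReal) (hφ : Measurable φ)
    {N : ℕ} (hN : 0 < N) (ξ : Fin N → X) (uF : EReal) (δ : Fin N → ℝ) (ε : Fin N → ℝ → ℝ)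
    (hmax : HasMaximalPoints μ φ ξ uF δ ε)
    (horbit : Pairwise fun i j => Disjoint (orbit f (ξ i)) (orbit f (ξ j)))
    (hrep : ∀ i, ξ i ∈ Function.periodicPts f → IsRepelling f (ξ i))
    (θ : Fin N → ℝ)
    (hθ : ∀ i, HasExtremalIndex μ f (localised φ (Metric.ball (ξ i) (δ i))) (θ i))
    (τ : ℝ) (hτ : 0 < τ) (u : ℕ → ℝ) (hu : IsNormalising μ φ u τ)
    (α : Fin N → ℝ)
    (hα : ∀ i, Tendsto
      (fun n : ℕ => μ.real (exceed φ (u n) ∩ Metric.ball (ξ i) (δ i)) / μ.real (exceed φ (u n)))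
      atTop (𝓝 (α i)))
    (q : ℕ) (hq : q = Finset.univ.sup fun i => Function.minimalPeriod f (ξ i))
    {C₁ : Type*} [NormedAddCommGroup C₁] [NormedSpace ℝ C₁] [CompleteSpace C₁]
    (toFun : C₁ →ₗ[ℝ] (X → ℝ)) (htoFun : ∀ g, Measurable (toFun g))
    (hA : AssumptionA μ f φ q u toFun) :
    (∃ t : ℕ → ℕ, CondD μ f φ q u t) ∧
    (∀ t : ℕ → ℕ, CondD μ f φ q u t → CondD' μ f φ q u t) ∧
    Tendsto (fun n : ℕ => μ.real {x | partialMax f φ n x ≤ (u n : EReal)}) atTop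
      (𝓝 (Real.exp (-((∑ i, α i * θ i) * τ)))) := by
  have hlev := hu.tendsto_levels hmax hτ
  have hqi : ∀ i, Function.minimalPeriod f (ξ i) ≤ q := fun i => by
    rw [hq]
    exact Finset.le_sup (f := fun i => Function.minimalPeriod f (ξ i)) (Finset.mem_univ i)
  obtain ⟨e, b, he, hb, hb₀, hbd⟩ := exists_error_bounds hμ hφ hu hA fun j hj =>
    eventually_escape_inter_preimage_eq_empty hf hmax horbit hrep hlev hqi hj
  refine ⟨⟨_, condD_of_bounds hb hb₀ fun n hn => (hbd n hn).2⟩,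
    fun t ht => condD'_of_bounds hu he (fun n hn => (hbd n hn).1) ht.1 ht.2.1, ?_⟩
  refine tendsto_partialMax_of_bounds hμ hφ hu hb (fun n hn => (hbd n hn).2 1 le_rfl) ?_
  have hloc : ∀ i, Tendsto (fun n : ℕ => (n : ℝ) *
      μ.real (escape f φ q (u n) ∩ Metric.ball (ξ i) (δ i))) atTop (𝓝 (θ i * (τ * α i))) :=
    fun i => tendsto_escape_inter_ball hf hμ hφ hmax horbit hlev i (hθ i) hu (hα i) he
      fun n hn => (hbd n hn).1
  have hsum := tendsto_finsetSum Finset.univ fun i _ => hloc i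
  have hval : ∑ i, θ i * (τ * α i) = (∑ i, α i * θ i) * τ := by
    rw [Finset.sum_mul]
    exact Finset.sum_congr rfl fun i _ => by ring
  rw [hval] at hsum
  refine hsum.congr' ?_
  filter_upwards [hmax.eventually_exceed_inter_ball hlev] with n hn
  rw [← Finset.mul_sum, ← measureReal_biUnion_finset]
  · congr 2
    ext x
    simp only [Finset.mem_univ, iUnion_true, mem_iUnion, mem_inter_iff, exists_and_left,
      and_iff_left_iff_imp]
    exact fun hx => hn.2 x hx.1
  · intro i _ j _ hij
    exact (hmax.disjoint_balls hij).mono inter_subset_right inter_subset_right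
  · exact fun i _ => (measurableSet_escape hμ.measurable hφ q (u n)).inter measurableSet_ball
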